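/- Let $V'\in\mathbb C(x)$ be a rational function and let $\gamma$ be a (simple, $C^1$) Jordan arc in $\mathbb C$, parametrized by $\mathbb R$, with a weight $e^{-V}$ on $\gamma$: a continuous function on $\gamma$, vanishing exactly at those points of $\gamma$ that are poles of $V'$, with $d(e^{-V})=-V'e^{-V}dx$ at all other points. Assume that $\gamma$ is admissible: for every polynomial $f$, $f e^{-V}$ tends to $0$ at both ends of $\gamma$, and $\int_\gamma f e^{-V}dx$ and $\int_\gamma fV'e^{-V}dx$ converge absolutely. Let $$Z_n=\frac1{n!}\int_{\gamma^n}\prod_{i<j}(\lambda_i-\lambda_j)^2\prod_i e^{-V(\lambda_i)}d\lambda_i ,$$ assume $Z_n\neq0$ for all $n\ge 0$, and write $\langle\cdot\rangle_n$ for the expectation with respect to the (possibly complex) eigenvalue measure $\frac{1}{n!\,Z_n}\prod_{i<j}(\lambda_i-\lambda_j)^2\prod_ie^{-V(\lambda_i)}d\lambda_i$ on $\gamma^n$. Put $p^{(n)}(x)=\langle\prod_i(x-\lambda_i)\rangle_n$, $h^{(n)}=\int_\gamma (p^{(n)})^2e^{-V}dx$, $S_n=\frac1{h^{(n)}}\int_\gamma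 x\,(p^{(n)})^2e^{-V}dx$; fix square roots $\sqrt{h^{(n)}}$, put $\gamma^{(n)}=\sqrt{h^{(n)}}/\sqrt{h^{(n-1)}}$ for $n\ge1$, and $$w_{n,m}(x)=\frac1{\sqrt{h^{(n)}}\sqrt{h^{(m)}}}\int_\gamma p^{(n)}(x')\frac{V'(x)-V'(x')}{x-x'}p^{(m)}(x')e^{-V(x')}dx' .$$ For $n\ge1$ let $$\mathcal D^{(n)}=\begin{pmatrix}\frac{V'}2&0\\0&-\frac{V'}2\end{pmatrix}+\begin{pmatrix}w_{n-1,n-1}&w_{n-1,n}\\w_{n,n-1}&w_{n,n}\end{pmatrix}\begin{pmatrix}0&-\gamma^{(n)}\\\gamma^{(n)}&0\end{pmatrix},\qquad \mathcal R^{(n)}(x)=\begin{pmatrix}0&1\\-\frac{\gamma^{(n)}}{\gamma^{(n+1)}}&\frac{x-S_n}{\gamma^{(n+1)}}\end{pmatrix},$$ $\mathcal R^{(n,k)}=\mathcal R^{(n+k-1)}\cdots\mathcal R^{(n)}$, $\ \mathcal D^{(n)}_k=(\mathcal R^{(n,k)})^{-1}\mathcal D^{(n+k)}\mathcal R^{(n,k)}$,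 and $\hat{\mathcal D}^{(n,0)}=\mathcal D^{(n)}$, $\hat{\mathcal D}^{(n,k+1)}=\frac{d}{dx}\hat{\mathcal D}^{(n,k)}+[\hat{\mathcal D}^{(n,k)},\mathcal D^{(n)}]$. For $x$ outside the closure $\overline\gamma$ and not a pole of $V'$, let $$W_1^{(n)}(x)=\Big\langle\sum_i\frac1{x-\lambda_i}\Big\rangle_n-\frac{V'(x)}2 .$$ Then for every $N\ge1$: 1. $\operatorname{Tr}\mathcal D^{(N)}(x)=0$ for every $x$ that is not a pole of $V'$. 2. (Recursion) There are polynomials $C^{(N,0)},\dots,C^{(N,3)}\in\mathbb C[x]$, not all zero, with $\sum_{k=0}^3C^{(N,k)}(x)\,\mathcal D^{(N)}_k(x)=0$ for all $x$ that are not poles of $V'$; and any such polynomials satisfy $\sum_{k=0}^3C^{(N,k)}(x)\,W_1^{(N+k)}(x)=0$ for all $x\notin\overline\gamma$ that are not poles of $V'$. 3. (ODE) There are polynomials $\hat C^{(N,0)},\dots,\hat C^{(N,3)}\in\mathbb C[x]$ with $\hat C^{(N,3)}\ne0$ and $\sum_{k=0}^3\hat C^{(N,k)}(x)\,\hat{\mathcal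 D}^{(N,k)}(x)=0$ for all $x$ that are not poles of $V'$; and any polynomials satisfying this relation satisfy $\sum_{k=0}^3\hat C^{(N,k)}(x)\,\frac{d^k}{dx^k}W_1^{(N)}(x)=0$ for all $x\notin\overline\gamma$ that are not poles of $V'$. 4. The unshifted resolvent $\big\langle\sum_i\frac1{x-\lambda_i}\big\rangle_n$ also satisfies, for the same $x$, a linear recursion $\sum_{k=0}^3 c_k(x)\big\langle\sum_i\frac1{x-\lambda_i}\big\rangle_{N+k}=0$ with polynomial coefficients, not all zero, and a linear ODE in $x$ at $n=N$ of order 3 with polynomial coefficients and nonzero leading coefficient (in general with other coefficients than in 2 and 3). -/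

import Mathlib

open Polynomial

namespace OneMatrixModel

noncomputable section

/-- The value at `x` of the rational function `dV` (the derivative `V'` of the potential);
only used at points that are not poles. -/
def val (dV : RatFunc ℂ) (x : ℂ) : ℂ := RatFunc.eval (RingHom.id ℂ) x dV

/-- `x` is a (finite) pole of the rational function `dV`. -/
def IsPole (dV : RatFunc ℂ) (x : ℂ) : Prop := dV.denom.eval x = 0

/-- `γ : ℝ → ℂ` is an admissible Jordan arc for a potential `V` with rational derivative `dV`, and
`ω t` is the value of `e ^ (-V)` at the point `γ t`. As `V` may have logarithmic singularities,
`e ^ (-V)` is given as a function along the arc: it is continuous, it vanishes exactly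
at the poles of `dV` (if the arc runs through any), and elsewhere `d(e ^ (-V)) = -V' e ^ (-V) dx`.
The ends of the arc, at `t → ± ∞`, may be finite or at infinity. -/
structure IsAdmissible (dV : RatFunc ℂ) (γ ω : ℝ → ℂ) : Prop where
  contDiff : ContDiff ℝ 1 γ
  injective : Function.Injective γ
  continuous_weight : Continuous ω
  weight_eq_zero_iff : ∀ t, ω t = 0 ↔ IsPole dV (γ t)
  hasDerivAt_weight : ∀ t, ¬ IsPole dV (γ t) →
    HasDerivAt ω (-(val dV (γ t)) * ω t * deriv γ t) t
  /-- The measure vanishes at the two ends of the arc. -/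
  tendsto_atTop : ∀ f : ℂ[X], Filter.Tendsto (fun t => f.eval (γ t) * ω t) Filter.atTop (nhds 0)
  tendsto_atBot : ∀ f : ℂ[X], Filter.Tendsto (fun t => f.eval (γ t) * ω t) Filter.atBot (nhds 0)
  /-- Absolute convergence of `∫ f e ^ (-V) dx` and `∫ f V' e ^ (-V) dx` for polynomials `f`. -/
  integrable : ∀ f : ℂ[X],
    MeasureTheory.Integrable (fun t : ℝ => f.eval (γ t) * ω t * deriv γ t)
  integrable_deriv : ∀ f : ℂ[X],
    MeasureTheory.Integrable (fun t : ℝ => f.eval (γ t) * val dV (γ t) * ω t * deriv γ t)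

/-- `∫_γ f(x) e ^ (-V(x)) dx`. -/
def lineInt (γ ω : ℝ → ℂ) (f : ℂ → ℂ) : ℂ := ∫ t : ℝ, f (γ t) * ω t * deriv γ t

/-- The Vandermonde product `Δ(Λ) = ∏_{i < j} (λ_i - λ_j)`. -/
def vandermonde {n : ℕ} (l : Fin n → ℂ) : ℂ := ∏ i, ∏ j ∈ Finset.Ioi i, (l i - l j)

/-- `∫_{γ ^ n} F(Λ) Δ(Λ) ^ 2 e ^ (-Tr V(Λ)) dλ_1 ⋯ dλ_n`. -/
def eigenInt (γ ω : ℝ → ℂ) (n : ℕ) (F : (Fin n → ℂ) → ℂ) : ℂ :=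
  ∫ t : Fin n → ℝ, F (fun i => γ (t i)) * vandermonde (fun i => γ (t i)) ^ 2 *
    ∏ i, (ω (t i) * deriv γ (t i))

/-- The partition function `Z`. -/
def partitionFn (γ ω : ℝ → ℂ) (n : ℕ) : ℂ :=
  1 / (n.factorial : ℂ) * eigenInt γ ω n (fun _ => 1)

/-- The expectation of `F(Λ)` with respect to the eigenvalue measure `dμ(Λ)` on `γ ^ n`. -/
def expect (γ ω : ℝ → ℂ) (n : ℕ) (F : (Fin n → ℂ) → ℂ) : ℂ :=
  1 / ((n.factorial : ℂ) * partitionFn γ ω n) * eigenInt γ ω n F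

/-- `p⁽ⁿ⁾(x)`, the expectation of the characteristic polynomial `det (x - Λ)`. -/
def orthoPoly (γ ω : ℝ → ℂ) (n : ℕ) (x : ℂ) : ℂ :=
  expect γ ω n (fun l => ∏ i, (x - l i))

/-- The expectation of `Tr (1 / (x - Λ))`. -/
def meanResolvent (γ ω : ℝ → ℂ) (n : ℕ) (x : ℂ) : ℂ :=
  expect γ ω n (fun l => ∑ i, 1 / (x - l i))

/-- `h⁽ⁿ⁾ = ∫_γ p⁽ⁿ⁾(x) ^ 2 e ^ (-V(x)) dx`. -/
def normSq (γ ω : ℝ → ℂ) (n : ℕ) : ℂ := lineInt γ ω (fun y => orthoPoly γ ω n y ^ 2)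

/-- `S_n`, the diagonal coefficient of the three-term recursion. -/
def jacobiS (γ ω : ℝ → ℂ) (n : ℕ) : ℂ :=
  1 / normSq γ ω n * lineInt γ ω (fun y => y * orthoPoly γ ω n y ^ 2)

/-! In what follows `r n` is a square root of `h⁽ⁿ⁾`. -/

/-- `γ⁽ⁿ⁾ = √(h⁽ⁿ⁾ / h⁽ⁿ⁻¹⁾)`, for `n ≥ 1`. -/
def jacobiG (r : ℕ → ℂ) (n : ℕ) : ℂ := r n / r (n - 1)

/-- `w_{n,m}(x)`. -/
def wEntry (dV : RatFunc ℂ) (γ ω : ℝ → ℂ) (r : ℕ → ℂ) (n m : ℕ) (x : ℂ) : ℂ :=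
  1 / (r n * r m) * lineInt γ ω (fun y =>
    orthoPoly γ ω n y * ((val dV x - val dV y) / (x - y)) * orthoPoly γ ω m y)

/-- The matrix `𝒟⁽ⁿ⁾(x)` of the differential system of the wave functions, for `n ≥ 1`. -/
def matD (dV : RatFunc ℂ) (γ ω : ℝ → ℂ) (r : ℕ → ℂ) (n : ℕ) (x : ℂ) : Matrix (Fin 2) (Fin 2) ℂ :=
  !![val dV x / 2, 0; 0, -(val dV x / 2)] +
    !![wEntry dV γ ω r (n - 1) (n - 1) x, wEntry dV γ ω r (n - 1) n x;
       wEntry dV γ ω r n (n - 1) x, wEntry dV γ ω r n n x] *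
    !![0, -jacobiG r n; jacobiG r n, 0]

/-- The shift matrix `ℛ⁽ⁿ⁾(x)`, for `n ≥ 1`. -/
def matR (γ ω : ℝ → ℂ) (r : ℕ → ℂ) (n : ℕ) (x : ℂ) : Matrix (Fin 2) (Fin 2) ℂ :=
  !![0, 1; -jacobiG r n / jacobiG r (n + 1), (x - jacobiS γ ω n) / jacobiG r (n + 1)]

/-- The iterated shift `ℛ⁽ⁿ'ᵏ⁾(x) = ℛ⁽ⁿ⁺ᵏ⁻¹⁾(x) ⋯ ℛ⁽ⁿ⁾(x)`. -/
def iterR (γ ω : ℝ → ℂ) (r : ℕ → ℂ) (n : ℕ) : ℕ → ℂ → Matrix (Fin 2) (Fin 2) ℂ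
  | 0, _ => 1
  | k + 1, x => matR γ ω r (n + k) x * iterR γ ω r n k x

/-- `𝒟⁽ⁿ⁾_k(x) = ℛ⁽ⁿ'ᵏ⁾(x)⁻¹ 𝒟⁽ⁿ⁺ᵏ⁾(x) ℛ⁽ⁿ'ᵏ⁾(x)`. -/
def shiftD (dV : RatFunc ℂ) (γ ω : ℝ → ℂ) (r : ℕ → ℂ) (n k : ℕ) (x : ℂ) :
    Matrix (Fin 2) (Fin 2) ℂ :=
  (iterR γ ω r n k x)⁻¹ * matD dV γ ω r (n + k) x * iterR γ ω r n k x

/-- `𝒟̂⁽ⁿ'⁰⁾ = 𝒟⁽ⁿ⁾` and `𝒟̂⁽ⁿ'ᵏ⁺¹⁾ = d𝒟̂⁽ⁿ'ᵏ⁾/dx + [𝒟̂⁽ⁿ'ᵏ⁾, 𝒟⁽ⁿ⁾]`. -/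
def hatD (dV : RatFunc ℂ) (γ ω : ℝ → ℂ) (r : ℕ → ℂ) (n : ℕ) :
    ℕ → ℂ → Matrix (Fin 2) (Fin 2) ℂ
  | 0, x => matD dV γ ω r n x
  | k + 1, x => Matrix.of (fun i j => deriv (fun y => hatD dV γ ω r n k y i j) x) +
      (hatD dV γ ω r n k x * matD dV γ ω r n x - matD dV γ ω r n x * hatD dV γ ω r n k x)

/-- The function `W₁⁽ⁿ⁾(x)` in the normalization of the determinantal formula
`W₁⁽ⁿ⁾ = Tr (Ψ' E Ψ⁻¹)`: the expectation of `Tr (1 / (x - Λ))` minus `V'(x) / 2`. -/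
def W1 (dV : RatFunc ℂ) (γ ω : ℝ → ℂ) (n : ℕ) (x : ℂ) : ℂ :=
  meanResolvent γ ω n x - val dV x / 2

end

end OneMatrixModel

open OneMatrixModel

/-!
The mean resolvent of the one-matrix model is a matrix element of a `2 × 2` linear system, and the
recursion and the differential equation are linear algebra in the space of `2 × 2` matrices.

Let `L f = ∫_γ f e ^ (-V) dx`, let `P_n` be the orthonormal polynomials of `L` and let
`Q_n(x) = L (P_n / (x - ·))` be the functions of the second kind. Andréief's identity turns the
integrals over `γ ^ n` into one-dimensional ones: the partition function is the product of the
squared norms, so that all of these are nonzero (`moment_sq_ne_zero`); the expected characteristic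
polynomial is the monic orthogonal polynomial (`orthoPoly_eq_eval`); and the expected resolvent is
`∑_{j < n} P_j(x) Q_j(x)` (`IsModel.meanResolvent_eq_sum`). Both `P_n(x)` and `Q_n(x)` satisfy the
three-term recursion, which gives Christoffel-Darboux formulas for `∑ P_j P_j` and `∑ P_j Q_j`.
Integration by parts along the arc then yields the differential system with matrix `𝒟` for
`(P_n, P_{n+1})` and `(Q_n, Q_{n+1})`.

Let `M` be the rank-one projector with entries `± γ⁽ⁿ⁺¹⁾ P_i Q_j`. Then `W₁ = Tr (𝒟 M)`
(`IsModel.W1_eq_trace`), the shift matrices conjugate `M` into the projector of the next level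
(`IsModel.matR_mul_M`), and `M' = [𝒟, M]` (`IsModel.hasDerivAt_M`). Hence
`W₁⁽ⁿ⁺ᵏ⁾ = Tr (𝒟⁽ⁿ⁾_k M)` and `dᵏ W₁⁽ⁿ⁾ / dxᵏ = Tr (𝒟̂⁽ⁿ'ᵏ⁾ M)`, so any linear relation between the
matrices is a linear relation between the functions. Four traceless `2 × 2` matrices of rational
functions are dependent. In the differential case the leading coefficient can be made nonzero,
since a relation of lower order may be differentiated (`exists_relation_last_ne_zero`).

For the resolvent without the shift by `V' / 2` the matrices are no longer traceless, but
`Tr (A M)` always lies in the two-dimensional space spanned by `Q_n` and `Q_{n+1}` over the rational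
functions (`IsModel.exists_trace_mul_M_eq`), which again forces linear relations.
-/

namespace OneMatrixModel

open MeasureTheory Filter Topology

/-! ### The functional `f ↦ ∫_γ f e ^ (-V) dx` and integration by parts -/

/-- Every polynomial multiple of `f` is integrable along `γ` against the weight `e ^ (-V)`. The
class of these functions is closed under all the operations needed below, which mere integrability
is not. -/
def IsTame (γ ω : ℝ → ℂ) (f : ℂ → ℂ) : Prop :=
  ∀ g : ℂ[X], Integrable (fun t : ℝ => g.eval (γ t) * f (γ t) * ω t * deriv γ t)

section Tame

variable {γ ω : ℝ → ℂ} {f g : ℂ → ℂ}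

lemma IsTame.integrable (hf : IsTame γ ω f) :
    Integrable (fun t : ℝ => f (γ t) * ω t * deriv γ t) := by
  simpa using hf 1

lemma IsTame.add (hf : IsTame γ ω f) (hg : IsTame γ ω g) : IsTame γ ω (fun y => f y + g y) := by
  intro p
  refine ((hf p).add (hg p)).congr (ae_of_all _ fun t => ?_)
  simp only [Pi.add_apply]
  ring

lemma IsTame.polynomial_mul (hf : IsTame γ ω f) (p : ℂ[X]) :
    IsTame γ ω (fun y => p.eval y * f y) := by
  intro q
  refine (hf (q * p)).congr (ae_of_all _ fun t => ?_)
  simp only [eval_mul]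
  ring

lemma IsTame.const_mul (hf : IsTame γ ω f) (c : ℂ) : IsTame γ ω (fun y => c * f y) := by
  simpa using hf.polynomial_mul (C c)

lemma IsTame.sub (hf : IsTame γ ω f) (hg : IsTame γ ω g) : IsTame γ ω (fun y => f y - g y) := by
  simpa [sub_eq_add_neg] using hf.add (hg.const_mul (-1))

lemma IsTame.sum {ι : Type*} (s : Finset ι) {f : ι → ℂ → ℂ} (hf : ∀ i ∈ s, IsTame γ ω (f i)) :
    IsTame γ ω (fun y => ∑ i ∈ s, f i y) := by
  intro p
  refine (integrable_finsetSum s fun i hi => hf i hi p).congr (ae_of_all _ fun t => ?_)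
  simp only [Finset.mul_sum, Finset.sum_mul]

lemma IsTame.congr (hf : IsTame γ ω f) (h : ∀ y, f y = g y) : IsTame γ ω g := by
  rwa [← funext h]

/-- A point outside the closure of the arc has positive distance to it. -/
lemma exists_dist_le (γ : ℝ → ℂ) {x : ℂ} (hx : x ∉ closure (Set.range γ)) :
    ∃ δ > 0, ∀ t, δ ≤ ‖x - γ t‖ := by
  rw [Metric.mem_closure_iff] at hx
  push Not at hx
  obtain ⟨δ, hδ, h⟩ := hx
  exact ⟨δ, hδ, fun t => by simpa [dist_eq_norm] using h _ ⟨t, rfl⟩⟩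

lemma sub_ne_zero_of_notMem_closure {x : ℂ} (hx : x ∉ closure (Set.range γ)) (t : ℝ) :
    x - γ t ≠ 0 := fun h => hx (subset_closure ⟨t, (sub_eq_zero.1 h).symm⟩)

lemma IsTame.div_sub (hγ : Continuous γ) (hf : IsTame γ ω f) {x : ℂ}
    (hx : x ∉ closure (Set.range γ)) : IsTame γ ω (fun y => f y / (x - y)) := by
  obtain ⟨δ, hδ, h⟩ := exists_dist_le γ hx
  intro p
  have hc : Continuous fun t => (x - γ t)⁻¹ :=
    (continuous_const.sub hγ).inv₀ fun t => sub_ne_zero_of_notMem_closure hx t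
  refine ((hf p).bdd_mul (c := δ⁻¹) hc.aestronglyMeasurable (ae_of_all _ fun t => ?_)).congr
    (ae_of_all _ fun t => ?_)
  · rw [norm_inv]
    exact inv_anti₀ hδ (h t)
  · simp only [div_eq_mul_inv]
    ring

lemma lineInt_add (hf : IsTame γ ω f) (hg : IsTame γ ω g) :
    lineInt γ ω (fun y => f y + g y) = lineInt γ ω f + lineInt γ ω g := by
  unfold lineInt
  rw [← integral_add hf.integrable hg.integrable]
  exact integral_congr_ae (ae_of_all _ fun t => by simp only; ring)

lemma lineInt_const_mul (c : ℂ) (f : ℂ → ℂ) :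
    lineInt γ ω (fun y => c * f y) = c * lineInt γ ω f := by
  unfold lineInt
  rw [← integral_const_mul]
  exact integral_congr_ae (ae_of_all _ fun t => by simp only; ring)

lemma lineInt_sub (hf : IsTame γ ω f) (hg : IsTame γ ω g) :
    lineInt γ ω (fun y => f y - g y) = lineInt γ ω f - lineInt γ ω g := by
  have h := lineInt_add hf (hg.const_mul (-1))
  rw [lineInt_const_mul] at h
  simpa [sub_eq_add_neg] using h

lemma lineInt_sum {ι : Type*} (s : Finset ι) {f : ι → ℂ → ℂ} (hf : ∀ i ∈ s, IsTame γ ω (f i)) :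
    lineInt γ ω (fun y => ∑ i ∈ s, f i y) = ∑ i ∈ s, lineInt γ ω (f i) := by
  unfold lineInt
  rw [← integral_finsetSum s fun i hi => (hf i hi).integrable]
  exact integral_congr_ae (ae_of_all _ fun t => by simp only [Finset.sum_mul])

/-- As `γ` is injective, changing the integrand on a finite subset of the plane does not change
the integral. -/
lemma lineInt_congr_of_finite (hγ : Function.Injective γ) {S : Set ℂ} (hS : S.Finite)
    (h : ∀ y, y ∉ S → f y = g y) : lineInt γ ω f = lineInt γ ω g := by
  have h0 : (γ ⁻¹' S).Finite := hS.preimage hγ.injOn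
  refine integral_congr_ae ?_
  filter_upwards [h0.countable.ae_notMem volume] with t ht
  rw [h _ ht]

lemma lineInt_congr_range (h : ∀ t, f (γ t) = g (γ t)) : lineInt γ ω f = lineInt γ ω g := by
  unfold lineInt
  simp only [h]

end Tame

section Admissible

variable {dV : RatFunc ℂ} {γ ω : ℝ → ℂ}

lemma IsAdmissible.isTame_polynomial (h : IsAdmissible dV γ ω) (p : ℂ[X]) :
    IsTame γ ω (fun y => p.eval y) := by
  intro q
  simpa using h.integrable (q * p)

lemma IsAdmissible.isTame_val_mul (h : IsAdmissible dV γ ω) (p : ℂ[X]) :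
    IsTame γ ω (fun y => val dV y * p.eval y) := by
  intro q
  refine (h.integrable_deriv (q * p)).congr (ae_of_all _ fun t => ?_)
  simp only [eval_mul]
  ring

lemma finite_setOf_isPole (dV : RatFunc ℂ) : {x | IsPole dV x}.Finite := by
  refine (dV.denom.rootSet_finite ℂ).subset fun x hx => ?_
  rw [mem_rootSet]
  exact ⟨dV.denom_ne_zero, by simpa [IsPole, aeval_def, eval₂_eq_eval_map] using hx⟩

/-- **Integration by parts** against `e ^ (-V) dx`. The fundamental theorem of calculus is applied
off the finitely many parameters at which `γ` meets a pole of `V'`, where the weight is only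
known to be continuous. -/
lemma IsAdmissible.lineInt_deriv (h : IsAdmissible dV γ ω) {g g' : ℂ → ℂ}
    (hg : ∀ t, HasDerivAt g (g' (γ t)) (γ t)) (hg' : IsTame γ ω g')
    (hVg : IsTame γ ω (fun y => val dV y * g y))
    (htop : Tendsto (fun t => g (γ t) * ω t) atTop (𝓝 0))
    (hbot : Tendsto (fun t => g (γ t) * ω t) atBot (𝓝 0)) :
    lineInt γ ω g' = lineInt γ ω (fun y => val dV y * g y) := by
  have hγ : ∀ t, HasDerivAt γ (deriv γ t) t := fun t =>
    (h.contDiff.differentiable one_ne_zero t).hasDerivAt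
  set F' : ℝ → ℂ := fun t =>
    g' (γ t) * ω t * deriv γ t - val dV (γ t) * g (γ t) * ω t * deriv γ t with hF'
  have hint : Integrable F' := hg'.integrable.sub hVg.integrable
  have hS : (γ ⁻¹' {x | IsPole dV x}).Countable :=
    ((finite_setOf_isPole dV).preimage h.injective.injOn).countable
  have hcont : Continuous fun t => g (γ t) * ω t :=
    (continuous_iff_continuousAt.2 fun t =>
      ((hg t).comp t (hγ t)).continuousAt).mul h.continuous_weight
  have hftc : ∀ n : ℕ, ∫ t in (-(n : ℝ))..n, F' t
      = g (γ n) * ω n - g (γ (-(n : ℝ))) * ω (-(n : ℝ)) := by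
    intro n
    refine integral_eq_of_hasDerivAt_off_countable (fun t => g (γ t) * ω t) F' hS
      hcont.continuousOn (fun t ht => ?_) hint.intervalIntegrable
    refine (((hg t).comp t (hγ t)).mul (h.hasDerivAt_weight t ht.2)).congr_deriv ?_
    simp only [hF', Function.comp]
    ring
  have hN : Tendsto (fun n : ℕ => (n : ℝ)) atTop atTop := tendsto_natCast_atTop_atTop
  have hN' : Tendsto (fun n : ℕ => -(n : ℝ)) atTop atBot := tendsto_neg_atTop_atBot.comp hN
  have h1 := intervalIntegral_tendsto_integral hint hN' hN
  simp only [hftc] at h1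
  have h2 := (htop.comp hN).sub (hbot.comp hN')
  have h3 := tendsto_nhds_unique h1 h2
  rw [hF', integral_sub hg'.integrable hVg.integrable, sub_zero] at h3
  exact sub_eq_zero.1 h3

lemma IsAdmissible.lineInt_derivative (h : IsAdmissible dV γ ω) (p : ℂ[X]) :
    lineInt γ ω (fun y => p.derivative.eval y) = lineInt γ ω (fun y => val dV y * p.eval y) :=
  h.lineInt_deriv (g := fun y => p.eval y) (g' := fun y => p.derivative.eval y)
    (fun t => p.hasDerivAt (γ t)) (h.isTame_polynomial _)
    (h.isTame_val_mul p) (h.tendsto_atTop p) (h.tendsto_atBot p)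

lemma IsAdmissible.continuous (h : IsAdmissible dV γ ω) : Continuous γ := h.contDiff.continuous

lemma IsAdmissible.lineInt_derivative_div (h : IsAdmissible dV γ ω) (p : ℂ[X]) {x : ℂ}
    (hx : x ∉ closure (Set.range γ)) :
    lineInt γ ω (fun y => p.derivative.eval y / (x - y) + p.eval y / (x - y) / (x - y)) =
      lineInt γ ω (fun y => val dV y * p.eval y / (x - y)) := by
  obtain ⟨δ, hδ, hd⟩ := exists_dist_le γ hx
  have hb : IsBoundedUnder (· ≤ ·) (atTop : Filter ℝ) (norm ∘ fun t => (x - γ t)⁻¹) ∧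
      IsBoundedUnder (· ≤ ·) (atBot : Filter ℝ) (norm ∘ fun t => (x - γ t)⁻¹) := by
    have : ∀ t, (norm ∘ fun t => (x - γ t)⁻¹) t ≤ δ⁻¹ := fun t => by
      simp only [Function.comp, norm_inv]
      exact inv_anti₀ hδ (hd t)
    exact ⟨isBoundedUnder_of ⟨_, this⟩, isBoundedUnder_of ⟨_, this⟩⟩
  have hcomm : ∀ t, (fun t => p.eval (γ t) * ω t * (x - γ t)⁻¹) t
      = (fun t => p.eval (γ t) / (x - γ t) * ω t) t := fun t => by
    simp only [div_eq_mul_inv]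
    ring
  have := h.lineInt_deriv (g := fun y => p.eval y / (x - y))
    (g' := fun y => p.derivative.eval y / (x - y) + p.eval y / (x - y) / (x - y))
    (fun t => ?_)
    (((h.isTame_polynomial _).div_sub h.continuous hx).add
      (((h.isTame_polynomial p).div_sub h.continuous hx).div_sub h.continuous hx))
    (((h.isTame_val_mul p).div_sub h.continuous hx).congr fun y => by
      rw [mul_div_assoc])
    (((h.tendsto_atTop p).zero_mul_isBoundedUnder_le hb.1).congr hcomm)
    (((h.tendsto_atBot p).zero_mul_isBoundedUnder_le hb.2).congr hcomm)
  · simpa only [mul_div_assoc] using this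
  · have hne := sub_ne_zero_of_notMem_closure hx t
    refine ((p.hasDerivAt (γ t)).div ((hasDerivAt_id (γ t)).const_sub x) hne).congr_deriv ?_
    simp only [id]
    field_simp
    ring

/-- The derivative of a Cauchy transform along the arc. -/
lemma IsAdmissible.hasDerivAt_lineInt_div (h : IsAdmissible dV γ ω) (p : ℂ[X]) {x : ℂ}
    (hx : x ∉ closure (Set.range γ)) :
    HasDerivAt (fun z => lineInt γ ω (fun y => p.eval y / (z - y)))
      (-lineInt γ ω (fun y => p.eval y / (x - y) / (x - y))) x := by
  obtain ⟨δ, hδ, hd⟩ := exists_dist_le γ hx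
  have hball : ∀ z ∈ Metric.ball x (δ / 2), ∀ t, δ / 2 ≤ ‖z - γ t‖ := by
    intro z hz t
    have h1 := hd t
    have h2 : ‖x - γ t‖ ≤ ‖x - z‖ + ‖z - γ t‖ := by
      simpa using norm_add_le (x - z) (z - γ t)
    rw [Metric.mem_ball, dist_comm, dist_eq_norm] at hz
    linarith
  have hout : ∀ z ∈ Metric.ball x (δ / 2), z ∉ closure (Set.range γ) := by
    intro z hz hmem
    rw [Metric.mem_closure_iff] at hmem
    obtain ⟨_, ⟨t, rfl⟩, ht⟩ := hmem (δ / 2) (by positivity)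
    rw [dist_eq_norm] at ht
    exact absurd (hball z hz t) (not_le.2 ht)
  have hmem : Metric.ball x (δ / 2) ∈ 𝓝 x := Metric.ball_mem_nhds x (by positivity)
  have hp := h.isTame_polynomial p
  have key := hasDerivAt_integral_of_dominated_loc_of_deriv_le (μ := volume)
    (F := fun z t => p.eval (γ t) / (z - γ t) * ω t * deriv γ t)
    (F' := fun z t => -(p.eval (γ t) / (z - γ t) / (z - γ t) * ω t * deriv γ t))
    (bound := fun t => (δ / 2)⁻¹ * (δ / 2)⁻¹ * ‖p.eval (γ t) * ω t * deriv γ t‖) hmem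
    (eventually_of_mem hmem fun z hz =>
      (hp.div_sub h.continuous (hout z hz)).integrable.aestronglyMeasurable)
    (hp.div_sub h.continuous hx).integrable
    ((hp.div_sub h.continuous hx).div_sub h.continuous hx).integrable.neg.aestronglyMeasurable
    (ae_of_all _ fun t z hz => ?_) (hp.integrable.norm.const_mul _)
    (ae_of_all _ fun t z hz => ?_)
  · refine key.2.congr_deriv ?_
    rw [integral_neg]
    rfl
  · have h1 : ‖(z - γ t)⁻¹‖ ≤ (δ / 2)⁻¹ := by
      rw [norm_inv]
      exact inv_anti₀ (by positivity) (hball z hz t)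
    have h2 : -(p.eval (γ t) / (z - γ t) / (z - γ t) * ω t * deriv γ t)
        = -((z - γ t)⁻¹ * (z - γ t)⁻¹ * (p.eval (γ t) * ω t * deriv γ t)) := by
      simp only [div_eq_mul_inv]
      ring
    rw [h2, norm_neg, norm_mul, norm_mul]
    gcongr
  · have hne := sub_ne_zero_of_notMem_closure (hout z hz) t
    have h1 := ((hasDerivAt_id z).sub_const (γ t)).fun_inv hne
    refine ((((h1.const_mul (p.eval (γ t))).mul_const (ω t)).mul_const (deriv γ t)).congr_deriv
      ?_).congr_of_eventuallyEq (Eventually.of_forall fun z => ?_)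
    · simp only [id]
      field_simp
    · simp only [id, div_eq_mul_inv]

end Admissible

/-! ### Orthogonal polynomials of a linear functional -/

/-- The monic polynomials obtained from `1, X, X ^ 2, …` by the Gram-Schmidt process for the
bilinear form `(p, q) ↦ L (p * q)`. They are orthogonal as long as `L (π_j ^ 2) ≠ 0`; where that
number vanishes, the junk value of the division drops the corresponding term. -/
noncomputable def orthSeq (L : ℂ[X] →ₗ[ℂ] ℂ) (n : ℕ) : ℂ[X] :=
  X ^ n - ∑ j : Fin n, C (L (X ^ n * orthSeq L j) / L (orthSeq L j ^ 2)) * orthSeq L j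
termination_by n
decreasing_by all_goals exact j.2

section OrthSeq

variable (L : ℂ[X] →ₗ[ℂ] ℂ)

lemma map_C_mul (c : ℂ) (p : ℂ[X]) : L (C c * p) = c * L p := by
  rw [← smul_eq_C_mul, map_smul, smul_eq_mul]

lemma orthSeq_monic_degree (n : ℕ) : (orthSeq L n).Monic ∧ (orthSeq L n).degree = n := by
  induction n using Nat.strong_induction_on with
  | _ n ih =>
    have hlt : (∑ j : Fin n, C (L (X ^ n * orthSeq L j) / L (orthSeq L j ^ 2)) *
        orthSeq L j).degree < n := by
      refine lt_of_le_of_lt (degree_sum_le _ _) ((Finset.sup_lt_iff (WithBot.bot_lt_coe n)).2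
        fun j _ => ?_)
      rw [← smul_eq_C_mul]
      refine lt_of_le_of_lt (degree_smul_le _ _) ?_
      rw [(ih j j.2).2]
      exact Nat.cast_lt.2 j.2
    rw [orthSeq]
    exact ⟨monic_X_pow_sub hlt, by
      rw [degree_sub_eq_left_of_degree_lt] <;> rw [degree_X_pow]; exact hlt⟩

lemma orthSeq_monic (n : ℕ) : (orthSeq L n).Monic := (orthSeq_monic_degree L n).1

lemma degree_orthSeq (n : ℕ) : (orthSeq L n).degree = n := (orthSeq_monic_degree L n).2

lemma natDegree_orthSeq (n : ℕ) : (orthSeq L n).natDegree = n :=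
  natDegree_eq_of_degree_eq_some (degree_orthSeq L n)

lemma orthSeq_orthogonal {n : ℕ} (h : ∀ j < n, L (orthSeq L j ^ 2) ≠ 0) :
    ∀ k ≤ n, ∀ j < k, L (orthSeq L k * orthSeq L j) = 0 := by
  intro k
  induction k using Nat.strong_induction_on with
  | _ k ih =>
    intro hk j hj
    have hoff : ∀ i : Fin k, i ≠ ⟨j, hj⟩ → L (orthSeq L i * orthSeq L j) = 0 := by
      intro i hi
      rcases lt_trichotomy (i : ℕ) j with h1 | h1 | h1
      · rw [mul_comm]
        exact ih j hj (by omega) i h1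
      · exact absurd (Fin.ext h1) hi
      · exact ih i i.2 (by omega) j h1
    rw [orthSeq, sub_mul, Finset.sum_mul, map_sub, map_sum, Finset.sum_eq_single ⟨j, hj⟩]
    · have hne := h j (by omega)
      rw [mul_assoc, map_C_mul, ← sq, div_mul_cancel₀ _ hne, sub_self]
    · intro i _ hi
      rw [mul_assoc, map_C_mul, hoff i hi, mul_zero]
    · simp

end OrthSeq

/-! ### Andréief's identity and Heine's formulas -/

section Andreief

variable {dV : RatFunc ℂ} {γ ω : ℝ → ℂ}

/-- **Andréief's identity**, with an additional factor `F i` for every variable. -/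
lemma integral_prod_mul_det_mul_det (n : ℕ) (F : Fin n → ℂ → ℂ) (φ ψ : Fin n → ℂ[X])
    (hF : ∀ i, IsTame γ ω (F i)) :
    Integrable (fun t : Fin n → ℝ => (∏ i, F i (γ (t i))) *
        (Matrix.of fun j i => (φ j).eval (γ (t i))).det *
        (Matrix.of fun j i => (ψ j).eval (γ (t i))).det * ∏ i, (ω (t i) * deriv γ (t i))) ∧
    ∫ t : Fin n → ℝ, (∏ i, F i (γ (t i))) *
        (Matrix.of fun j i => (φ j).eval (γ (t i))).det *
        (Matrix.of fun j i => (ψ j).eval (γ (t i))).det * ∏ i, (ω (t i) * deriv γ (t i)) =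
      ∑ σ : Equiv.Perm (Fin n), ∑ τ : Equiv.Perm (Fin n),
        ((Equiv.Perm.sign σ : ℤ) : ℂ) * ((Equiv.Perm.sign τ : ℤ) : ℂ) *
          ∏ i, lineInt γ ω (fun y => (φ (σ i)).eval y * ((ψ (τ i)).eval y * F i y)) := by
  have hexp : ∀ t : Fin n → ℝ, (∏ i, F i (γ (t i))) *
        (Matrix.of fun j i => (φ j).eval (γ (t i))).det *
        (Matrix.of fun j i => (ψ j).eval (γ (t i))).det * ∏ i, (ω (t i) * deriv γ (t i)) =
      ∑ σ : Equiv.Perm (Fin n), ∑ τ : Equiv.Perm (Fin n),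
        ((Equiv.Perm.sign σ : ℤ) : ℂ) * ((Equiv.Perm.sign τ : ℤ) : ℂ) *
          ∏ i, ((φ (σ i)).eval (γ (t i)) * ((ψ (τ i)).eval (γ (t i)) * F i (γ (t i))) *
            ω (t i) * deriv γ (t i)) := by
    intro t
    rw [Matrix.det_apply', Matrix.det_apply', mul_assoc _ (∑ σ, _) (∑ τ, _), Finset.sum_mul_sum,
      Finset.mul_sum, Finset.sum_mul]
    refine Finset.sum_congr rfl fun σ _ => ?_
    rw [Finset.mul_sum, Finset.sum_mul]
    refine Finset.sum_congr rfl fun τ _ => ?_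
    simp only [Matrix.of_apply, Finset.prod_mul_distrib]
    ring
  have hint : ∀ σ τ : Equiv.Perm (Fin n), Integrable (fun t : Fin n → ℝ =>
      ((Equiv.Perm.sign σ : ℤ) : ℂ) * ((Equiv.Perm.sign τ : ℤ) : ℂ) *
        ∏ i, ((φ (σ i)).eval (γ (t i)) * ((ψ (τ i)).eval (γ (t i)) * F i (γ (t i))) *
          ω (t i) * deriv γ (t i))) := by
    intro σ τ
    refine Integrable.const_mul ?_ _
    exact Integrable.fintype_prod (f := fun i s => (φ (σ i)).eval (γ s) *
      ((ψ (τ i)).eval (γ s) * F i (γ s)) * ω s * deriv γ s) fun i =>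
        (((hF i).polynomial_mul _).polynomial_mul _).integrable
  simp only [hexp]
  refine ⟨integrable_finsetSum _ fun σ _ => integrable_finsetSum _ fun τ _ => hint σ τ, ?_⟩
  rw [integral_finsetSum _ fun σ _ => integrable_finsetSum _ fun τ _ => hint σ τ]
  refine Finset.sum_congr rfl fun σ _ => ?_
  rw [integral_finsetSum _ fun τ _ => hint σ τ]
  refine Finset.sum_congr rfl fun τ _ => ?_
  rw [integral_const_mul, integral_fintype_prod_volume_eq_prod (fun i s => (φ (σ i)).eval (γ s) *
      ((ψ (τ i)).eval (γ s) * F i (γ s)) * ω s * deriv γ s)]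
  rfl

/-- The case `F = 1` of Andréief's identity, with the double sum written as a determinant. -/
lemma integral_det_mul_det (h : IsAdmissible dV γ ω) (n : ℕ) (φ ψ : Fin n → ℂ[X]) :
    Integrable (fun t : Fin n → ℝ => (Matrix.of fun j i => (φ j).eval (γ (t i))).det *
        (Matrix.of fun j i => (ψ j).eval (γ (t i))).det * ∏ i, (ω (t i) * deriv γ (t i))) ∧
    ∫ t : Fin n → ℝ, (Matrix.of fun j i => (φ j).eval (γ (t i))).det *
        (Matrix.of fun j i => (ψ j).eval (γ (t i))).det * ∏ i, (ω (t i) * deriv γ (t i)) =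
      n.factorial * (Matrix.of fun j k =>
        lineInt γ ω (fun y => (φ j * ψ k).eval y)).det := by
  have h1 := integral_prod_mul_det_mul_det n (fun _ _ => 1) φ ψ
    (fun _ => by simpa using h.isTame_polynomial 1)
  simp only [Finset.prod_const_one, one_mul, mul_one, ← eval_mul] at h1
  refine ⟨h1.1, ?_⟩
  rw [h1.2]
  have h2 : ∀ σ : Equiv.Perm (Fin n), ∑ τ : Equiv.Perm (Fin n),
      ((Equiv.Perm.sign σ : ℤ) : ℂ) * ((Equiv.Perm.sign τ : ℤ) : ℂ) *
        ∏ i, lineInt γ ω (fun y => (φ (σ i) * ψ (τ i)).eval y) =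
      (Matrix.of fun j k => lineInt γ ω (fun y => (φ j * ψ k).eval y)).det := by
    intro σ
    set A := Matrix.of fun j k => lineInt γ ω (fun y => (φ j * ψ k).eval y) with hA
    have h3 : (A.submatrix σ id).det = ((Equiv.Perm.sign σ : ℤ) : ℂ) * A.det :=
      Matrix.det_permute σ A
    have h4 : ((Equiv.Perm.sign σ : ℤ) : ℂ) * ((Equiv.Perm.sign σ : ℤ) : ℂ) = 1 := by
      rw [← Int.cast_mul, ← Units.val_mul, Int.units_mul_self]
      simp
    rw [← one_mul A.det, ← h4, mul_assoc, ← h3, ← Matrix.det_transpose, Matrix.det_apply',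
      Finset.mul_sum]
    refine Finset.sum_congr rfl fun τ _ => ?_
    rw [mul_assoc]
    rfl
  rw [Finset.sum_congr rfl fun σ _ => h2 σ, Finset.sum_const, Finset.card_univ, Fintype.card_perm,
    Fintype.card_fin, nsmul_eq_mul]

lemma prod_Ioi_sub_eq_det {n : ℕ} (l : Fin n → ℂ) (φ : Fin n → ℂ[X])
    (hdeg : ∀ i, (φ i).natDegree = i) (hm : ∀ i, (φ i).Monic) :
    ∏ i, ∏ j ∈ Finset.Ioi i, (l j - l i) = (Matrix.of fun j i => (φ j).eval (l i)).det := by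
  rw [← Matrix.det_vandermonde, Matrix.det_eval_matrixOfPolynomials_eq_det_vandermonde l φ hdeg hm,
    ← Matrix.det_transpose]
  rfl

lemma vandermonde_sq {n : ℕ} (l : Fin n → ℂ) (φ : Fin n → ℂ[X])
    (hdeg : ∀ i, (φ i).natDegree = i) (hm : ∀ i, (φ i).Monic) :
    OneMatrixModel.vandermonde l ^ 2 = (Matrix.of fun j i => (φ j).eval (l i)).det ^ 2 := by
  rw [← prod_Ioi_sub_eq_det l φ hdeg hm, OneMatrixModel.vandermonde]
  simp only [← Finset.prod_pow]
  exact Finset.prod_congr rfl fun i _ => Finset.prod_congr rfl fun j _ => by ring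

end Andreief

section Heine

variable {dV : RatFunc ℂ} {γ ω : ℝ → ℂ}

/-- The moment functional `p ↦ ∫_γ p e ^ (-V) dx` on polynomials. -/
noncomputable def IsAdmissible.moment (h : IsAdmissible dV γ ω) : ℂ[X] →ₗ[ℂ] ℂ where
  toFun p := lineInt γ ω (fun y => p.eval y)
  map_add' p q := by
    simp only [eval_add]
    exact lineInt_add (h.isTame_polynomial p) (h.isTame_polynomial q)
  map_smul' c p := by
    simp only [eval_smul, smul_eq_mul, RingHom.id_apply]
    exact lineInt_const_mul c _

lemma IsAdmissible.moment_apply (h : IsAdmissible dV γ ω) (p : ℂ[X]) :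
    h.moment p = lineInt γ ω (fun y => p.eval y) := rfl

/-- The pairs of distinct monic polynomials of degree less than `n` are orthogonal. -/
def OrthBelow (L : ℂ[X] →ₗ[ℂ] ℂ) (n : ℕ) : Prop :=
  ∀ j < n, ∀ k < n, j ≠ k → L (orthSeq L j * orthSeq L k) = 0

lemma orthBelow_succ {L : ℂ[X] →ₗ[ℂ] ℂ} {n : ℕ} (h : ∀ j < n, L (orthSeq L j ^ 2) ≠ 0) :
    OrthBelow L (n + 1) := by
  intro j hj k hk hjk
  rcases lt_or_gt_of_ne hjk with h1 | h1
  · rw [mul_comm]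
    exact orthSeq_orthogonal L h k (by omega) j h1
  · exact orthSeq_orthogonal L h j (by omega) k h1

/-- The squared Vandermonde product, written through the monic orthogonal polynomials. -/
lemma vandermonde_sq_eq_det_orthSeq (L : ℂ[X] →ₗ[ℂ] ℂ) {n : ℕ} (l : Fin n → ℂ) :
    OneMatrixModel.vandermonde l ^ 2 =
      (Matrix.of fun j i : Fin n => (orthSeq L j).eval (l i)).det ^ 2 :=
  vandermonde_sq l (fun j => orthSeq L j) (fun i => natDegree_orthSeq L i)
    (fun i => orthSeq_monic L i)

lemma eigenInt_one (h : IsAdmissible dV γ ω) {n : ℕ} (ho : OrthBelow h.moment n) :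
    eigenInt γ ω n (fun _ => 1) =
      n.factorial * ∏ j : Fin n, h.moment (orthSeq h.moment j ^ 2) := by
  have h1 := (integral_det_mul_det h n (fun j => orthSeq h.moment j)
    (fun j => orthSeq h.moment j)).2
  unfold eigenInt
  simp only [one_mul, vandermonde_sq_eq_det_orthSeq h.moment, sq (Matrix.det _)]
  rw [h1, ← Matrix.det_diagonal]
  congr 2
  ext j k
  by_cases hjk : j = k
  · subst hjk
    simp [Matrix.diagonal_apply_eq, IsAdmissible.moment_apply, sq]
  · rw [Matrix.diagonal_apply_ne _ hjk]
    exact ho j j.2 k k.2 fun hh => hjk (Fin.ext hh)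

lemma partitionFn_eq (h : IsAdmissible dV γ ω) {n : ℕ} (ho : OrthBelow h.moment n) :
    partitionFn γ ω n = ∏ j : Fin n, h.moment (orthSeq h.moment j ^ 2) := by
  have : (n.factorial : ℂ) ≠ 0 := Nat.cast_ne_zero.2 n.factorial_ne_zero
  rw [partitionFn, eigenInt_one h ho]
  field_simp

/-- As `Z_{n + 1}` is the product of the first `n + 1` squared norms, none of them vanishes. -/
lemma moment_sq_ne_zero (h : IsAdmissible dV γ ω) (hZ : ∀ n, partitionFn γ ω n ≠ 0) (n : ℕ) :
    h.moment (orthSeq h.moment n ^ 2) ≠ 0 := by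
  induction n using Nat.strong_induction_on with
  | _ n ih =>
    have h1 := hZ (n + 1)
    rw [partitionFn_eq h (orthBelow_succ ih), Finset.prod_ne_zero_iff] at h1
    exact h1 (Fin.last n) (Finset.mem_univ _)

lemma orthBelow (h : IsAdmissible dV γ ω) (hZ : ∀ n, partitionFn γ ω n ≠ 0) (n : ℕ) :
    OrthBelow h.moment n := by
  intro j hj k hk hjk
  exact orthBelow_succ (n := n) (fun j _ => moment_sq_ne_zero h hZ j) j (by omega) k (by omega) hjk

/-- Adding the variable `x` to a Vandermonde determinant and expanding it along that variable. -/
lemma prod_sub_mul_det_eq_sum (L : ℂ[X] →ₗ[ℂ] ℂ) {n : ℕ} (l : Fin n → ℂ) (x : ℂ) :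
    (∏ i, (l i - x)) * (Matrix.of fun j i : Fin n => (orthSeq L j).eval (l i)).det =
      ∑ j : Fin (n + 1), (-1) ^ (j : ℕ) * (orthSeq L j).eval x *
        (Matrix.of fun k i : Fin n => (orthSeq L (j.succAbove k : Fin (n + 1))).eval (l i)).det := by
  rw [← prod_Ioi_sub_eq_det l (fun j => orthSeq L j) (fun i => natDegree_orthSeq L i)
    (fun i => orthSeq_monic L i)]
  have h1 := prod_Ioi_sub_eq_det (Fin.cons x l : Fin (n + 1) → ℂ) (fun j => orthSeq L j)
    (fun i => natDegree_orthSeq L i) (fun i => orthSeq_monic L i)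
  rw [Fin.prod_univ_succ, Fin.prod_Ioi_zero] at h1
  simp only [Fin.prod_Ioi_succ, Fin.cons_succ, Fin.cons_zero] at h1
  rw [h1, Matrix.det_succ_column_zero]
  rfl

/-- **Heine's formula**: the expected characteristic polynomial is the monic orthogonal
polynomial. -/
lemma orthoPoly_eq_eval (h : IsAdmissible dV γ ω) (hZ : ∀ n, partitionFn γ ω n ≠ 0) (n : ℕ)
    (x : ℂ) : orthoPoly γ ω n x = (orthSeq h.moment n).eval x := by
  have hfac : (n.factorial : ℂ) ≠ 0 := Nat.cast_ne_zero.2 n.factorial_ne_zero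
  set L := h.moment with hL
  have key : eigenInt γ ω n (fun l => ∏ i, (x - l i)) =
      (n.factorial : ℂ) * partitionFn γ ω n * (orthSeq L n).eval x := by
    have hpt : ∀ t : Fin n → ℝ, (∏ i, (x - γ (t i))) *
        OneMatrixModel.vandermonde (fun i => γ (t i)) ^ 2 * ∏ i, (ω (t i) * deriv γ (t i)) =
        ∑ j : Fin (n + 1), (-1) ^ n * ((-1) ^ (j : ℕ) * (orthSeq L j).eval x) *
        ((Matrix.of fun k i : Fin n =>
            (orthSeq L (j.succAbove k : Fin (n + 1))).eval (γ (t i))).det *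
          (Matrix.of fun j i : Fin n => (orthSeq L j).eval (γ (t i))).det *
          ∏ i, (ω (t i) * deriv γ (t i))) := by
      intro t
      have h1 : ∏ i, (x - γ (t i)) = (-1) ^ n * ∏ i, (γ (t i) - x) := by
        rw [← Fin.prod_const n (-1 : ℂ), ← Finset.prod_mul_distrib]
        exact Finset.prod_congr rfl fun i _ => by ring
      have h2 := prod_sub_mul_det_eq_sum L (fun i => γ (t i)) x
      calc _ = (-1) ^ n * ((∏ i, (γ (t i) - x)) *
              (Matrix.of fun j i : Fin n => (orthSeq L j).eval (γ (t i))).det) *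
            (Matrix.of fun j i : Fin n => (orthSeq L j).eval (γ (t i))).det *
            ∏ i, (ω (t i) * deriv γ (t i)) := by
              rw [h1, vandermonde_sq_eq_det_orthSeq L]
              ring
        _ = _ := by
              rw [h2, Finset.mul_sum, Finset.sum_mul, Finset.sum_mul]
              exact Finset.sum_congr rfl fun j _ => by ring
    have hdet := fun j : Fin (n + 1) => integral_det_mul_det h n
      (fun k => orthSeq L (j.succAbove k : Fin (n + 1))) (fun k => orthSeq L k)
    unfold eigenInt
    simp only [hpt]
    rw [integral_finsetSum _ fun j _ => (hdet j).1.const_mul _]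
    simp only [integral_const_mul]
    rw [Finset.sum_eq_single (Fin.last n)]
    · rw [(hdet (Fin.last n)).2, partitionFn_eq h (orthBelow h hZ n)]
      have h3 : (Matrix.of fun j k : Fin n => lineInt γ ω (fun y =>
          (orthSeq L ((Fin.last n).succAbove j : Fin (n + 1)) * orthSeq L k).eval y)).det =
          ∏ j : Fin n, h.moment (orthSeq h.moment j ^ 2) := by
        rw [← Matrix.det_diagonal]
        congr 1
        ext j k
        by_cases hjk : j = k
        · subst hjk
          simp [Matrix.diagonal_apply_eq, IsAdmissible.moment_apply, sq, hL]
        · rw [Matrix.diagonal_apply_ne _ hjk, Matrix.of_apply, Fin.succAbove_last,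
            Fin.val_castSucc]
          exact orthBelow h hZ n j j.2 k k.2 fun hh => hjk (Fin.ext hh)
      rw [h3, Fin.val_last]
      have h4 : ((-1 : ℂ) ^ n) * (-1) ^ n = 1 := by rw [← mul_pow]; simp
      linear_combination (eval x (orthSeq L n) * n.factorial *
        ∏ j : Fin n, h.moment (orthSeq h.moment j ^ 2)) * h4
    · -- the minor contains `π_n`, which is orthogonal to `π_0, …, π_{n - 1}`
      intro j _ hj
      obtain ⟨k, hk⟩ := Fin.exists_succAbove_eq hj.symm
      rw [(hdet j).2, Matrix.det_eq_zero_of_row_eq_zero k, mul_zero, mul_zero]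
      intro i
      rw [Matrix.of_apply, hk, Fin.val_last]
      exact orthBelow h hZ (n + 1) n (by omega) i (by omega) (by omega)
    · simp
  have hZn := hZ n
  rw [orthoPoly, expect, key]
  field_simp

/-- The expectation of a linear statistic `∑ f(λ_i)` is the integral of `f` against the diagonal
`∑_{j < n} π_j² / h_j` of the Christoffel-Darboux kernel. -/
lemma expect_sum_eq (h : IsAdmissible dV γ ω) (hZ : ∀ n, partitionFn γ ω n ≠ 0) (n : ℕ)
    {f : ℂ → ℂ} (hf : IsTame γ ω f) :
    expect γ ω n (fun l => ∑ i, f (l i)) = ∑ j : Fin n,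
      lineInt γ ω (fun y => (orthSeq h.moment j).eval y * ((orthSeq h.moment j).eval y * f y)) /
        h.moment (orthSeq h.moment j ^ 2) := by
  have hfac : (n.factorial : ℂ) ≠ 0 := Nat.cast_ne_zero.2 n.factorial_ne_zero
  set L := h.moment with hL
  set g : Fin n → ℂ := fun j => lineInt γ ω (fun y => (orthSeq L j).eval y *
    ((orthSeq L j).eval y * f y)) / L (orthSeq L j ^ 2) with hg
  have hone : IsTame γ ω (fun _ => 1) := by simpa using h.isTame_polynomial 1
  let F : Fin n → Fin n → ℂ → ℂ := fun i k => if k = i then f else fun _ => 1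
  have hFt : ∀ i k, IsTame γ ω (F i k) := fun i k => by
    by_cases hk : k = i
    · simpa [F, hk] using hf
    · simpa [F, hk] using hone
  have hpt : ∀ t : Fin n → ℝ, (∑ i, f (γ (t i))) *
      OneMatrixModel.vandermonde (fun i => γ (t i)) ^ 2 * ∏ i, (ω (t i) * deriv γ (t i)) =
      ∑ i, (∏ k, F i k (γ (t k))) *
        (Matrix.of fun j i : Fin n => (orthSeq L j).eval (γ (t i))).det *
        (Matrix.of fun j i : Fin n => (orthSeq L j).eval (γ (t i))).det *
        ∏ i, (ω (t i) * deriv γ (t i)) := by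
    intro t
    rw [vandermonde_sq_eq_det_orthSeq L, Finset.sum_mul, Finset.sum_mul]
    refine Finset.sum_congr rfl fun i _ => ?_
    have : ∏ k, F i k (γ (t k)) = f (γ (t i)) := by
      rw [Finset.prod_eq_single i]
      · simp [F]
      · intro k _ hk
        simp [F, hk]
      · simp
    rw [this]
    ring
  have hA := fun i => integral_prod_mul_det_mul_det n (F i) (fun j => orthSeq L j)
    (fun j => orthSeq L j) (hFt i)
  have hperm : ∀ i, ∀ σ : Equiv.Perm (Fin n), ∑ τ : Equiv.Perm (Fin n),
      ((Equiv.Perm.sign σ : ℤ) : ℂ) * ((Equiv.Perm.sign τ : ℤ) : ℂ) *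
        ∏ k, lineInt γ ω (fun y => (orthSeq L (σ k)).eval y *
          ((orthSeq L (τ k)).eval y * F i k y)) =
      g (σ i) * ∏ j : Fin n, L (orthSeq L j ^ 2) := by
    intro i σ
    rw [Finset.sum_eq_single σ]
    · have h4 : ((Equiv.Perm.sign σ : ℤ) : ℂ) * ((Equiv.Perm.sign σ : ℤ) : ℂ) = 1 := by
        rw [← Int.cast_mul, ← Units.val_mul, Int.units_mul_self]
        simp
      rw [h4, one_mul, ← Equiv.prod_comp σ (fun j : Fin n => L (orthSeq L j ^ 2)),
        ← Finset.mul_prod_erase _ _ (Finset.mem_univ i),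
        ← Finset.mul_prod_erase _ (fun k => L (orthSeq L (σ k) ^ 2)) (Finset.mem_univ i),
        ← mul_assoc]
      congr 1
      · rw [hg]
        simp only [F, if_true]
        rw [div_mul_cancel₀ _ (moment_sq_ne_zero h hZ _)]
      · refine Finset.prod_congr rfl fun k hk => ?_
        simp [F, Finset.ne_of_mem_erase hk, hL, IsAdmissible.moment_apply, sq]
    · -- two distinct permutations differ at some index other than `i`
      intro τ _ hτ
      have : ∃ k, k ≠ i ∧ σ k ≠ τ k := by
        by_contra hcon
        push Not at hcon
        refine hτ (Equiv.ext fun m => ?_)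
        by_cases hm : m = i
        · subst hm
          by_cases h5 : σ.symm (τ m) = m
          · rw [← h5, Equiv.apply_symm_apply, h5]
          · have h6 := hcon _ h5
            rw [Equiv.apply_symm_apply] at h6
            exact absurd (τ.injective h6).symm h5
        · exact (hcon m hm).symm
      obtain ⟨k, hk, hne⟩ := this
      rw [Finset.prod_eq_zero (Finset.mem_univ k), mul_zero]
      simp only [F, if_neg hk, mul_one, ← eval_mul]
      exact orthBelow h hZ n _ (σ k).2 _ (τ k).2 fun hh => hne (Fin.ext hh)
    · simp
  have key : eigenInt γ ω n (fun l => ∑ i, f (l i)) =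
      n.factorial * partitionFn γ ω n * ∑ j, g j := by
    unfold eigenInt
    simp only [hpt]
    rw [integral_finsetSum _ fun i _ => (hA i).1]
    simp only [(hA _).2, hperm]
    rw [Finset.sum_comm, partitionFn_eq h (orthBelow h hZ n)]
    simp only [← Finset.sum_mul, Equiv.sum_comp _ g]
    rw [Finset.sum_const, Finset.card_univ, Fintype.card_perm, Fintype.card_fin, nsmul_eq_mul]
    ring
  have hZn := hZ n
  rw [expect, key]
  field_simp

end Heine

/-! ### Orthonormal polynomials, three-term recursion and Christoffel-Darboux formula -/

/-- `P` is a sequence of polynomials, `P n` of degree `n`, orthonormal for the bilinear form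
`(p, q) ↦ L (p * q)`. -/
structure IsOrthonormal (L : ℂ[X] →ₗ[ℂ] ℂ) (P : ℕ → ℂ[X]) : Prop where
  degree_eq : ∀ n, (P n).degree = n
  map_mul : ∀ m n, L (P m * P n) = if m = n then 1 else 0

namespace IsOrthonormal

variable {L : ℂ[X] →ₗ[ℂ] ℂ} {P : ℕ → ℂ[X]}

lemma eq_sum (H : IsOrthonormal L P) : ∀ (n : ℕ) (f : ℂ[X]), f.degree < n →
    f = ∑ j ∈ Finset.range n, C (L (f * P j)) * P j := by
  intro n
  induction n with
  | zero =>
    intro f hf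
    have : f = 0 := by
      rw [← degree_eq_bot]
      exact Nat.WithBot.lt_zero_iff.1 (by simpa using hf)
    simp [this]
  | succ n ih =>
    intro f hf
    have hlead : (P n).coeff n ≠ 0 := by
      have h0 := coeff_natDegree (p := P n)
      rw [natDegree_eq_of_degree_eq_some (H.degree_eq n)] at h0
      rw [h0]
      exact leadingCoeff_ne_zero.2 fun h0 => by simpa [h0] using H.degree_eq n
    set c := f.coeff n / (P n).coeff n with hc
    have hg : (f - C c * P n).degree < n := by
      rw [degree_lt_iff_coeff_zero]
      intro m hm
      rcases hm.lt_or_eq with hm | rfl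
      · rw [coeff_sub, coeff_C_mul, coeff_eq_zero_of_degree_lt (hf.trans_le (by exact_mod_cast hm)),
          coeff_eq_zero_of_degree_lt (by rw [H.degree_eq]; exact_mod_cast hm)]
        simp
      · rw [coeff_sub, coeff_C_mul, hc, div_mul_cancel₀ _ hlead, sub_self]
    have h1 := ih _ hg
    have h2 : ∀ j, j ≠ n → L ((f - C c * P n) * P j) = L (f * P j) := by
      intro j hj
      rw [sub_mul, map_sub, mul_assoc, map_C_mul, H.map_mul, if_neg hj.symm]
      simp
    have h3 : L (f * P n) = c := by
      have h4 : L ((f - C c * P n) * P n) = 0 := by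
        rw [h1, Finset.sum_mul, map_sum]
        refine Finset.sum_eq_zero fun j hj => ?_
        rw [mul_assoc, map_C_mul, H.map_mul, if_neg (Finset.mem_range.1 hj).ne, mul_zero]
      rw [sub_mul, map_sub, mul_assoc, map_C_mul, H.map_mul, if_pos rfl, mul_one] at h4
      exact sub_eq_zero.1 h4
    have h5 : f - C c * P n = ∑ j ∈ Finset.range n, C (L (f * P j)) * P j :=
      h1.trans (Finset.sum_congr rfl fun j hj => by rw [h2 j (Finset.mem_range.1 hj).ne])
    rw [Finset.sum_range_succ, h3, ← h5]
    ring

lemma map_mul_eq_zero (H : IsOrthonormal L P) {n : ℕ} {f : ℂ[X]} (hf : f.degree < n) :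
    L (f * P n) = 0 := by
  rw [H.eq_sum n f hf, Finset.sum_mul, map_sum]
  refine Finset.sum_eq_zero fun j hj => ?_
  rw [mul_assoc, map_C_mul, H.map_mul, if_neg (Finset.mem_range.1 hj).ne, mul_zero]

lemma degree_X_mul (H : IsOrthonormal L P) (n : ℕ) :
    (X * P n).degree = ((n + 1 : ℕ) : WithBot ℕ) := by
  rw [degree_mul, degree_X, H.degree_eq, add_comm]
  rfl

lemma X_mul_zero (H : IsOrthonormal L P) :
    X * P 0 = C (L (X * P 0 * P 1)) * P 1 + C (L (X * P 0 * P 0)) * P 0 := by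
  have h1 := H.eq_sum 2 (X * P 0) (by rw [H.degree_X_mul]; exact_mod_cast one_lt_two)
  rw [Finset.sum_range_succ, Finset.sum_range_one] at h1
  rw [add_comm]
  exact h1

lemma X_mul_succ (H : IsOrthonormal L P) (n : ℕ) :
    X * P (n + 1) = C (L (X * P (n + 1) * P (n + 2))) * P (n + 2) +
      C (L (X * P (n + 1) * P (n + 1))) * P (n + 1) + C (L (X * P n * P (n + 1))) * P n := by
  have h1 := H.eq_sum (n + 3) (X * P (n + 1))
    (by rw [H.degree_X_mul]; exact Nat.cast_lt.2 (by omega))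
  rw [Finset.sum_range_succ, Finset.sum_range_succ, Finset.sum_range_succ,
    Finset.sum_eq_zero fun j hj => ?_, zero_add] at h1
  · rw [show X * P n * P (n + 1) = X * P (n + 1) * P n by ring]
    refine h1.trans ?_
    ring
  · rw [show X * P (n + 1) * P j = X * P j * P (n + 1) by ring, H.map_mul_eq_zero]
    · simp
    · rw [H.degree_X_mul]
      have := Finset.mem_range.1 hj
      exact Nat.cast_lt.2 (by omega)

end IsOrthonormal

/-- The **Christoffel-Darboux formula** for two solutions `p`, `F` of the same three-term recursion
at the spectral parameters `z`, `x`; the recursion of `F` may have an inhomogeneous term `d` at its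
start, as that of the functions of the second kind has. -/
lemma christoffel_darboux {R : Type*} [CommRing R] {p F G S : ℕ → R} {z x d : R}
    (hp0 : z * p 0 = G 1 * p 1 + S 0 * p 0)
    (hp : ∀ n, z * p (n + 1) = G (n + 2) * p (n + 2) + S (n + 1) * p (n + 1) + G (n + 1) * p n)
    (hF0 : x * F 0 = G 1 * F 1 + S 0 * F 0 + d)
    (hF : ∀ n, x * F (n + 1) = G (n + 2) * F (n + 2) + S (n + 1) * F (n + 1) + G (n + 1) * F n)
    (n : ℕ) :
    (z - x) * ∑ j ∈ Finset.range (n + 1), p j * F j =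
      G (n + 1) * (p (n + 1) * F n - p n * F (n + 1)) - p 0 * d := by
  induction n with
  | zero =>
    rw [Finset.sum_range_one]
    linear_combination F 0 * hp0 - p 0 * hF0
  | succ n ih =>
    rw [Finset.sum_range_succ, mul_add, ih]
    linear_combination F (n + 1) * hp n - p (n + 1) * hF n

/-! ### The wave functions of the matrix model -/

/-- The standing assumptions: an admissible arc, nonvanishing partition functions, and square roots
`r n` of the `h⁽ⁿ⁾`. -/
structure IsModel (dV : RatFunc ℂ) (γ ω : ℝ → ℂ) (r : ℕ → ℂ) : Prop where
  adm : IsAdmissible dV γ ω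
  partitionFn_ne_zero : ∀ n, partitionFn γ ω n ≠ 0
  sq_eq : ∀ n, r n ^ 2 = normSq γ ω n

namespace IsModel

variable {dV : RatFunc ℂ} {γ ω : ℝ → ℂ} {r : ℕ → ℂ}

/-- The normalized orthogonal polynomial `P_n = p⁽ⁿ⁾ / √h⁽ⁿ⁾`. -/
noncomputable def P (H : IsModel dV γ ω r) (n : ℕ) : ℂ[X] :=
  C (r n)⁻¹ * orthSeq H.adm.moment n

/-- The function of the second kind `Q_n(x) = ∫_γ P_n(y) / (x - y) e ^ (-V(y)) dy`. -/
noncomputable def Q (H : IsModel dV γ ω r) (n : ℕ) (x : ℂ) : ℂ :=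
  lineInt γ ω (fun y => (H.P n).eval y / (x - y))

lemma normSq_eq (H : IsModel dV γ ω r) (n : ℕ) :
    normSq γ ω n = H.adm.moment (orthSeq H.adm.moment n ^ 2) := by
  simp only [normSq, orthoPoly_eq_eval H.adm H.partitionFn_ne_zero, IsAdmissible.moment_apply,
    eval_pow]

lemma r_ne_zero (H : IsModel dV γ ω r) (n : ℕ) : r n ≠ 0 := by
  intro h
  have h1 := H.sq_eq n
  rw [H.normSq_eq, h] at h1
  exact moment_sq_ne_zero H.adm H.partitionFn_ne_zero n (by rw [← h1]; simp)

lemma orthSeq_eq (H : IsModel dV γ ω r) (n : ℕ) : orthSeq H.adm.moment n = C (r n) * H.P n := by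
  rw [P, ← mul_assoc, ← C_mul, mul_inv_cancel₀ (H.r_ne_zero n), C_1, one_mul]

lemma orthoPoly_eq (H : IsModel dV γ ω r) (n : ℕ) (y : ℂ) :
    orthoPoly γ ω n y = r n * (H.P n).eval y := by
  rw [orthoPoly_eq_eval H.adm H.partitionFn_ne_zero, H.orthSeq_eq, eval_mul, eval_C]

lemma isOrthonormal (H : IsModel dV γ ω r) : IsOrthonormal H.adm.moment H.P where
  degree_eq n := by
    rw [P, degree_C_mul (inv_ne_zero (H.r_ne_zero n)), degree_orthSeq]
  map_mul m n := by
    rw [P, P, mul_assoc, map_C_mul, mul_left_comm, map_C_mul]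
    by_cases h : m = n
    · subst h
      have := H.r_ne_zero m
      rw [← sq, ← H.normSq_eq, ← H.sq_eq, if_pos rfl]
      field_simp
    · rw [if_neg h, orthBelow H.adm H.partitionFn_ne_zero (m + n + 1) m (by omega) n (by omega) h]
      simp

lemma jacobiG_ne_zero (H : IsModel dV γ ω r) (n : ℕ) : jacobiG r n ≠ 0 :=
  div_ne_zero (H.r_ne_zero _) (H.r_ne_zero _)

lemma moment_X_mul_succ (H : IsModel dV γ ω r) (n : ℕ) :
    H.adm.moment (X * H.P n * H.P (n + 1)) = jacobiG r (n + 1) := by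
  have hdeg : (X * orthSeq H.adm.moment n - orthSeq H.adm.moment (n + 1)).degree
      < ((n + 1 : ℕ) : WithBot ℕ) := by
    have h1 : (X * orthSeq H.adm.moment n).degree = ((n + 1 : ℕ) : WithBot ℕ) := by
      rw [degree_mul, degree_X, degree_orthSeq, add_comm]
      rfl
    rw [← h1]
    refine degree_sub_lt_left (by rw [h1, degree_orthSeq]) ?_ ?_
    · exact (monic_X.mul (orthSeq_monic _ _)).ne_zero
    · rw [(monic_X.mul (orthSeq_monic _ _)).leadingCoeff, (orthSeq_monic _ _).leadingCoeff]
  have h2 := H.isOrthonormal.map_mul_eq_zero hdeg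
  have hr := H.r_ne_zero n
  rw [H.orthSeq_eq n, H.orthSeq_eq (n + 1), sub_mul, map_sub, mul_assoc (C _) (H.P (n + 1)),
    map_C_mul, H.isOrthonormal.map_mul, if_pos rfl, mul_left_comm X, mul_assoc (C (r n)),
    map_C_mul, mul_one] at h2
  rw [jacobiG, Nat.add_sub_cancel, eq_div_iff hr]
  linear_combination h2

lemma moment_X_mul_self (H : IsModel dV γ ω r) (n : ℕ) :
    H.adm.moment (X * H.P n * H.P n) = jacobiS γ ω n := by
  have hr := H.r_ne_zero n
  have h1 : lineInt γ ω (fun y => y * orthoPoly γ ω n y ^ 2) =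
      r n ^ 2 * H.adm.moment (X * H.P n * H.P n) := by
    rw [IsAdmissible.moment_apply, ← lineInt_const_mul]
    congr 1
    ext y
    rw [H.orthoPoly_eq, eval_mul, eval_mul, eval_X]
    ring
  rw [jacobiS, h1, ← H.sq_eq]
  field_simp

lemma X_mul_P_zero (H : IsModel dV γ ω r) :
    X * H.P 0 = C (jacobiG r 1) * H.P 1 + C (jacobiS γ ω 0) * H.P 0 := by
  have h := H.isOrthonormal.X_mul_zero
  rwa [H.moment_X_mul_succ 0, H.moment_X_mul_self 0] at h

lemma X_mul_P_succ (H : IsModel dV γ ω r) (n : ℕ) :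
    X * H.P (n + 1) = C (jacobiG r (n + 2)) * H.P (n + 2) +
      C (jacobiS γ ω (n + 1)) * H.P (n + 1) + C (jacobiG r (n + 1)) * H.P n := by
  have h := H.isOrthonormal.X_mul_succ n
  rwa [H.moment_X_mul_succ (n + 1), H.moment_X_mul_self (n + 1), H.moment_X_mul_succ n] at h

lemma mul_eval_P_zero (H : IsModel dV γ ω r) (x : ℂ) :
    x * (H.P 0).eval x = jacobiG r 1 * (H.P 1).eval x + jacobiS γ ω 0 * (H.P 0).eval x := by
  simpa using congrArg (eval x) H.X_mul_P_zero

lemma mul_eval_P_succ (H : IsModel dV γ ω r) (x : ℂ) (n : ℕ) :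
    x * (H.P (n + 1)).eval x = jacobiG r (n + 2) * (H.P (n + 2)).eval x +
      jacobiS γ ω (n + 1) * (H.P (n + 1)).eval x + jacobiG r (n + 1) * (H.P n).eval x := by
  simpa using congrArg (eval x) (H.X_mul_P_succ n)

lemma P_zero (H : IsModel dV γ ω r) : H.P 0 = C (r 0)⁻¹ := by
  rw [P, orthSeq]
  simp

lemma isTame_div (H : IsModel dV γ ω r) (p : ℂ[X]) {x : ℂ}
    (hx : x ∉ closure (Set.range γ)) : IsTame γ ω (fun y => p.eval y / (x - y)) :=
  (H.adm.isTame_polynomial p).div_sub H.adm.continuous hx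

/-- Multiplication by `x` in a function of the second kind. -/
lemma mul_Q (H : IsModel dV γ ω r) (n : ℕ) {x : ℂ} (hx : x ∉ closure (Set.range γ)) :
    x * H.Q n x = H.adm.moment (H.P n) +
      lineInt γ ω (fun y => (X * H.P n).eval y / (x - y)) := by
  rw [Q, ← lineInt_const_mul, IsAdmissible.moment_apply,
    ← lineInt_add (H.adm.isTame_polynomial _) (H.isTame_div _ hx)]
  refine lineInt_congr_range fun t => ?_
  have := sub_ne_zero_of_notMem_closure hx t
  rw [eval_mul, eval_X]
  field_simp
  ring

lemma moment_P (H : IsModel dV γ ω r) (n : ℕ) :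
    H.adm.moment (H.P n) = if n = 0 then r 0 else 0 := by
  have h0 := H.isOrthonormal.map_mul 0 n
  rw [H.P_zero, map_C_mul, inv_mul_eq_iff_eq_mul₀ (H.r_ne_zero 0)] at h0
  rw [h0]
  by_cases hn : n = 0 <;> simp [hn, eq_comm]

lemma mul_Q_zero (H : IsModel dV γ ω r) {x : ℂ} (hx : x ∉ closure (Set.range γ)) :
    x * H.Q 0 x = jacobiG r 1 * H.Q 1 x + jacobiS γ ω 0 * H.Q 0 x + r 0 := by
  rw [H.mul_Q 0 hx, H.moment_P, if_pos rfl, H.X_mul_P_zero, add_comm]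
  congr 1
  rw [Q, Q, ← lineInt_const_mul, ← lineInt_const_mul,
    ← lineInt_add ((H.isTame_div _ hx).const_mul _) ((H.isTame_div _ hx).const_mul _)]
  refine lineInt_congr_range fun t => ?_
  simp only [eval_add, eval_mul, eval_C]
  ring

lemma mul_Q_succ (H : IsModel dV γ ω r) {x : ℂ} (hx : x ∉ closure (Set.range γ)) (n : ℕ) :
    x * H.Q (n + 1) x = jacobiG r (n + 2) * H.Q (n + 2) x +
      jacobiS γ ω (n + 1) * H.Q (n + 1) x + jacobiG r (n + 1) * H.Q n x := by
  rw [H.mul_Q (n + 1) hx, H.moment_P, if_neg n.succ_ne_zero, H.X_mul_P_succ, zero_add]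
  rw [Q, Q, Q, ← lineInt_const_mul, ← lineInt_const_mul, ← lineInt_const_mul,
    ← lineInt_add ((H.isTame_div _ hx).const_mul _) ((H.isTame_div _ hx).const_mul _),
    ← lineInt_add (((H.isTame_div _ hx).const_mul _).add ((H.isTame_div _ hx).const_mul _))
      ((H.isTame_div _ hx).const_mul _)]
  refine lineInt_congr_range fun t => ?_
  simp only [eval_add, eval_mul, eval_C]
  ring

/-- The Christoffel-Darboux formula for `P` and `Q`, as an identity of polynomials in the
argument of `P`. -/
lemma X_sub_C_mul_sum_P_Q (H : IsModel dV γ ω r) {x : ℂ} (hx : x ∉ closure (Set.range γ))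
    (n : ℕ) :
    (X - C x) * ∑ j ∈ Finset.range (n + 1), H.P j * C (H.Q j x) =
      C (jacobiG r (n + 1)) * (H.P (n + 1) * C (H.Q n x) - H.P n * C (H.Q (n + 1) x)) - 1 := by
  rw [christoffel_darboux (p := H.P) (F := fun j => C (H.Q j x))
    (G := fun j => C (jacobiG r j)) (S := fun j => C (jacobiS γ ω j)) (d := C (r 0))
    H.X_mul_P_zero H.X_mul_P_succ (by simp only [← C_mul, ← C_add, H.mul_Q_zero hx])
    (fun n => by simp only [← C_mul, ← C_add, H.mul_Q_succ hx])]
  rw [H.P_zero, ← C_mul, inv_mul_cancel₀ (H.r_ne_zero 0), C_1]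

lemma X_sub_C_mul_sum_P_P (H : IsModel dV γ ω r) (x : ℂ) (n : ℕ) :
    (X - C x) * ∑ j ∈ Finset.range (n + 1), H.P j * C ((H.P j).eval x) =
      C (jacobiG r (n + 1)) *
        (H.P (n + 1) * C ((H.P n).eval x) - H.P n * C ((H.P (n + 1)).eval x)) := by
  rw [christoffel_darboux (p := H.P) (F := fun j => C ((H.P j).eval x))
    (G := fun j => C (jacobiG r j)) (S := fun j => C (jacobiS γ ω j)) (d := 0)
    H.X_mul_P_zero H.X_mul_P_succ
    (by simp only [← C_mul, ← C_add, H.mul_eval_P_zero, add_zero])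
    (fun n => by simp only [← C_mul, ← C_add, H.mul_eval_P_succ])]
  ring

/-- The Wronskian-type determinant of the wave functions is constant. -/
lemma jacobiG_mul_sub_eq_one (H : IsModel dV γ ω r) {x : ℂ} (hx : x ∉ closure (Set.range γ))
    (n : ℕ) : jacobiG r (n + 1) *
      ((H.P (n + 1)).eval x * H.Q n x - (H.P n).eval x * H.Q (n + 1) x) = 1 := by
  have h := congrArg (eval x) (H.X_sub_C_mul_sum_P_Q hx n)
  simp only [eval_mul, eval_sub, eval_X, eval_C, sub_self, zero_mul, eval_one] at h
  linear_combination -h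

/-- The diagonal of the kernel `∑ P_j Q_j`, from the derivative of the Christoffel-Darboux
formula. -/
lemma sum_P_mul_Q (H : IsModel dV γ ω r) {x : ℂ} (hx : x ∉ closure (Set.range γ)) (n : ℕ) :
    ∑ j ∈ Finset.range (n + 1), (H.P j).eval x * H.Q j x = jacobiG r (n + 1) *
      ((H.P (n + 1)).derivative.eval x * H.Q n x - (H.P n).derivative.eval x * H.Q (n + 1) x) := by
  have h := congrArg (fun p => eval x (derivative p)) (H.X_sub_C_mul_sum_P_Q hx n)
  simp only [derivative_mul, derivative_sub, derivative_X, derivative_C, derivative_one, eval_mul,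
    eval_sub, eval_add, eval_X, eval_C, sub_self, zero_mul, sub_zero, one_mul, add_zero,
    zero_add, mul_zero, eval_finsetSum] at h
  exact h

/-- A polynomial of degree at most `n` may be pulled out of the integral defining `Q_n`. -/
lemma lineInt_mul_P_div (H : IsModel dV γ ω r) {x : ℂ} (hx : x ∉ closure (Set.range γ)) {n : ℕ}
    {p : ℂ[X]} (hp : p.degree ≤ n) :
    lineInt γ ω (fun y => (p * H.P n).eval y / (x - y)) = p.eval x * H.Q n x := by
  have hq : H.adm.moment ((p /ₘ (X - C x)) * H.P n) = 0 := by
    by_cases hp0 : p = 0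
    · simp [hp0]
    refine H.isOrthonormal.map_mul_eq_zero (lt_of_lt_of_le ?_ hp)
    exact degree_divByMonic_lt p _ hp0 (by simp)
  have h2 := lineInt_sub ((H.isTame_div (H.P n) hx).const_mul (p.eval x))
    (H.adm.isTame_polynomial ((p /ₘ (X - C x)) * H.P n))
  rw [← H.adm.moment_apply, hq, sub_zero, lineInt_const_mul] at h2
  rw [Q, ← h2]
  refine lineInt_congr_range fun t => ?_
  have hne := sub_ne_zero_of_notMem_closure hx t
  have h3 := congrArg (eval (γ t)) (modByMonic_add_div p (X - C x))
  rw [modByMonic_X_sub_C_eq_C_eval] at h3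
  simp only [eval_add, eval_mul, eval_sub, eval_X, eval_C] at h3 ⊢
  field_simp
  rw [← h3]
  ring

lemma meanResolvent_eq_sum (H : IsModel dV γ ω r) {x : ℂ} (hx : x ∉ closure (Set.range γ))
    (n : ℕ) : meanResolvent γ ω n x = ∑ j ∈ Finset.range n, (H.P j).eval x * H.Q j x := by
  have hone : IsTame γ ω (fun y => 1 / (x - y)) := by
    simpa using H.isTame_div 1 hx
  rw [meanResolvent, expect_sum_eq H.adm H.partitionFn_ne_zero n hone, ← Fin.sum_univ_eq_sum_range
    (fun j => (H.P j).eval x * H.Q j x)]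
  refine Finset.sum_congr rfl fun j _ => ?_
  have hr := H.r_ne_zero j
  rw [← H.lineInt_mul_P_div hx (H.isOrthonormal.degree_eq j).le, ← H.normSq_eq, ← H.sq_eq,
    div_eq_iff (pow_ne_zero 2 hr), mul_comm, ← lineInt_const_mul]
  congr 1
  ext y
  rw [H.orthSeq_eq, eval_mul, eval_mul, eval_C]
  ring

/-! ### The differential system of the wave functions -/

lemma wEntry_eq (H : IsModel dV γ ω r) (n m : ℕ) (x : ℂ) :
    wEntry dV γ ω r n m x = lineInt γ ω (fun y =>
      (H.P n).eval y * ((val dV x - val dV y) / (x - y)) * (H.P m).eval y) := by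
  have hn := H.r_ne_zero n
  have hm := H.r_ne_zero m
  rw [wEntry, ← lineInt_const_mul]
  congr 1
  ext y
  rw [H.orthoPoly_eq, H.orthoPoly_eq]
  field_simp

lemma wEntry_comm (n m : ℕ) (x : ℂ) : wEntry dV γ ω r n m x = wEntry dV γ ω r m n x := by
  rw [wEntry, wEntry, mul_comm (r n)]
  congr 2
  ext y
  ring

lemma isTame_kernel (H : IsModel dV γ ω r) (n m : ℕ) {x : ℂ} (hx : x ∉ closure (Set.range γ)) :
    IsTame γ ω (fun y =>
      (H.P n).eval y * ((val dV x - val dV y) / (x - y)) * (H.P m).eval y) := by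
  refine ((((H.adm.isTame_polynomial (H.P n * H.P m)).const_mul (val dV x)).sub
    (H.adm.isTame_val_mul (H.P n * H.P m))).div_sub H.adm.continuous hx).congr fun y => ?_
  rw [eval_mul]
  ring

/-- The integral of `V' P_m` against a Christoffel-Darboux kernel `∑ P_j F_j` is expressed through
the functions `w`, by writing `V'(y)` as `V'(x) - (V'(x) - V'(y))`. -/
lemma sum_mul_lineInt_val (H : IsModel dV γ ω r) {x : ℂ} (hx : x ∉ closure (Set.range γ))
    {n : ℕ} {F : ℕ → ℂ} {c : ℂ}
    (hF : (X - C x) * ∑ j ∈ Finset.range (n + 1), H.P j * C (F j) =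
      C (jacobiG r (n + 1)) * (H.P (n + 1) * C (F n) - H.P n * C (F (n + 1))) - C c) (m : ℕ) :
    ∑ j ∈ Finset.range (n + 1), F j * lineInt γ ω (fun y => val dV y * (H.P m * H.P j).eval y) =
      jacobiG r (n + 1) *
        (F n * wEntry dV γ ω r m (n + 1) x - F (n + 1) * wEntry dV γ ω r m n x) +
      c * lineInt γ ω (fun y => val dV y * (H.P m).eval y / (x - y)) +
      val dV x * ((∑ j ∈ Finset.range (n + 1), F j * if m = j then 1 else 0) - c * H.Q m x) := by
  have h0 : lineInt γ ω (fun y => ∑ j ∈ Finset.range (n + 1),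
      F j * (val dV y * (H.P m * H.P j).eval y)) = ∑ j ∈ Finset.range (n + 1),
      F j * lineInt γ ω (fun y => val dV y * (H.P m * H.P j).eval y) := by
    rw [lineInt_sum _ fun j _ => (H.adm.isTame_val_mul _).const_mul _]
    simp only [lineInt_const_mul]
  have h0' : lineInt γ ω (fun y => ∑ j ∈ Finset.range (n + 1),
      F j * (H.P m * H.P j).eval y) = ∑ j ∈ Finset.range (n + 1),
      F j * if m = j then 1 else 0 := by
    rw [lineInt_sum _ fun j _ => (H.adm.isTame_polynomial _).const_mul _]
    simp only [lineInt_const_mul, ← H.adm.moment_apply, H.isOrthonormal.map_mul]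
  have t1 := (((H.isTame_kernel m (n + 1) hx).const_mul (F n)).sub
    ((H.isTame_kernel m n hx).const_mul (F (n + 1)))).const_mul (jacobiG r (n + 1))
  have t2 := ((H.adm.isTame_val_mul (H.P m)).div_sub H.adm.continuous hx).const_mul c
  have t3 : IsTame γ ω (fun y => ∑ j ∈ Finset.range (n + 1), F j * (H.P m * H.P j).eval y) :=
    IsTame.sum _ fun j _ => (H.adm.isTame_polynomial _).const_mul _
  have t4 := (H.isTame_div (H.P m) hx).const_mul c
  have h1 := lineInt_add (t1.add t2) ((t3.sub t4).const_mul (val dV x))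
  rw [lineInt_add t1 t2, lineInt_const_mul (jacobiG r (n + 1)),
    lineInt_sub ((H.isTame_kernel m (n + 1) hx).const_mul (F n))
      ((H.isTame_kernel m n hx).const_mul (F (n + 1))), lineInt_const_mul, lineInt_const_mul,
    lineInt_const_mul, lineInt_const_mul, lineInt_sub t3 t4, h0', lineInt_const_mul,
    ← H.wEntry_eq, ← H.wEntry_eq] at h1
  rw [← h0, Q, ← h1]
  refine lineInt_congr_range fun t => ?_
  have hne := sub_ne_zero_of_notMem_closure hx t
  have hK := congrArg (eval (γ t)) hF
  simp only [eval_mul, eval_sub, eval_X, eval_C, eval_finsetSum] at hK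
  have e1 : ∑ j ∈ Finset.range (n + 1), F j * (val dV (γ t) * (H.P m * H.P j).eval (γ t)) =
      val dV (γ t) * (H.P m).eval (γ t) *
        ∑ j ∈ Finset.range (n + 1), (H.P j).eval (γ t) * F j := by
    rw [Finset.mul_sum]
    refine Finset.sum_congr rfl fun j _ => ?_
    rw [eval_mul]
    ring
  have e2 : ∑ j ∈ Finset.range (n + 1), F j * (H.P m * H.P j).eval (γ t) =
      (H.P m).eval (γ t) * ∑ j ∈ Finset.range (n + 1), (H.P j).eval (γ t) * F j := by
    rw [Finset.mul_sum]
    refine Finset.sum_congr rfl fun j _ => ?_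
    rw [eval_mul]
    ring
  simp only [e1, e2]
  set K := ∑ j ∈ Finset.range (n + 1), (H.P j).eval (γ t) * F j
  field_simp
  linear_combination ((H.P m).eval (γ t) * (val dV x - val dV (γ t))) * hK

/-- Integration by parts gives the coefficients of `P_m'` in the basis `P_j`. -/
lemma derivative_P_eq (H : IsModel dV γ ω r) {n m : ℕ} (hnm : n ≤ m) (hmn : m ≤ n + 1) :
    (H.P m).derivative = ∑ j ∈ Finset.range (n + 1),
      C (lineInt γ ω (fun y => val dV y * (H.P m * H.P j).eval y)) * H.P j := by
  have hne : ∀ j, H.P j ≠ 0 := fun j h0 => by simpa [h0] using H.isOrthonormal.degree_eq j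
  have hdeg : ∀ j, (H.P j).derivative.degree < j := fun j => by
    have := degree_derivative_lt (hne j)
    rwa [H.isOrthonormal.degree_eq] at this
  rw [H.isOrthonormal.eq_sum (n + 1) (H.P m).derivative
    ((hdeg m).trans_le (Nat.cast_le.2 hmn))]
  refine Finset.sum_congr rfl fun j hj => ?_
  have hj' : j ≤ m := by have := Finset.mem_range.1 hj; omega
  have h1 := H.adm.lineInt_derivative (H.P m * H.P j)
  rw [← H.adm.moment_apply, derivative_mul, map_add, mul_comm (H.P m) (derivative _),
    H.isOrthonormal.map_mul_eq_zero ((hdeg j).trans_le (Nat.cast_le.2 hj')), add_zero] at h1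
  rw [h1]

lemma sum_mul_ite_eq {n m : ℕ} (hnm : n ≤ m) (F : ℕ → ℂ) :
    (∑ j ∈ Finset.range (n + 1), F j * if m = j then 1 else 0) = if m = n then F n else 0 := by
  simp only [mul_ite, mul_one, mul_zero, Finset.sum_ite_eq, Finset.mem_range]
  by_cases h : m = n
  · simp [h]
  · rw [if_neg h, if_neg (by omega)]

lemma eval_derivative_P (H : IsModel dV γ ω r) {x : ℂ} (hx : x ∉ closure (Set.range γ))
    {n m : ℕ} (hnm : n ≤ m) (hmn : m ≤ n + 1) :
    (H.P m).derivative.eval x = jacobiG r (n + 1) * ((H.P n).eval x * wEntry dV γ ω r m (n + 1) x -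
      (H.P (n + 1)).eval x * wEntry dV γ ω r m n x) +
      val dV x * if m = n then (H.P n).eval x else 0 := by
  have h1 := H.sum_mul_lineInt_val hx (n := n) (F := fun j => (H.P j).eval x) (c := 0)
    (by rw [H.X_sub_C_mul_sum_P_P, C_0, sub_zero]) m
  rw [sum_mul_ite_eq hnm (fun j => (H.P j).eval x), zero_mul, zero_mul, sub_zero, add_zero] at h1
  rw [H.derivative_P_eq hnm hmn, ← h1, eval_finsetSum]
  exact Finset.sum_congr rfl fun j _ => by rw [eval_mul, eval_C, mul_comm]

/-- The functions of the second kind satisfy the same system as the polynomials, with the opposite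
sign of `V' / 2` after removal of the factors `e ^ (∓ V / 2)`: the inhomogeneous term of the
Christoffel-Darboux formula cancels the term `V' P_m / (x - y)` of the integration by parts. -/
lemma hasDerivAt_Q (H : IsModel dV γ ω r) {x : ℂ} (hx : x ∉ closure (Set.range γ))
    {n m : ℕ} (hnm : n ≤ m) (hmn : m ≤ n + 1) :
    HasDerivAt (H.Q m) (jacobiG r (n + 1) * (H.Q n x * wEntry dV γ ω r m (n + 1) x -
      H.Q (n + 1) x * wEntry dV γ ω r m n x) +
      val dV x * (if m = n then H.Q n x else 0) - val dV x * H.Q m x) x := by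
  refine (H.adm.hasDerivAt_lineInt_div (H.P m) hx).congr_deriv ?_
  have h1 := H.sum_mul_lineInt_val hx (n := n) (F := fun j => H.Q j x) (c := 1)
    (by rw [H.X_sub_C_mul_sum_P_Q hx, C_1]) m
  rw [sum_mul_ite_eq hnm (fun j => H.Q j x)] at h1
  have h2 := H.adm.lineInt_derivative_div (H.P m) hx
  rw [lineInt_add (H.isTame_div _ hx) ((H.isTame_div _ hx).div_sub H.adm.continuous hx)] at h2
  have h3 : lineInt γ ω (fun y => (H.P m).derivative.eval y / (x - y)) =
      ∑ j ∈ Finset.range (n + 1),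
        H.Q j x * lineInt γ ω (fun y => val dV y * (H.P m * H.P j).eval y) := by
    rw [H.derivative_P_eq hnm hmn]
    have : ∀ j, H.Q j x * lineInt γ ω (fun y => val dV y * (H.P m * H.P j).eval y) =
        lineInt γ ω (fun y => lineInt γ ω (fun y => val dV y * (H.P m * H.P j).eval y) *
          ((H.P j).eval y / (x - y))) := fun j => by
      rw [lineInt_const_mul, mul_comm, Q]
    simp only [this]
    rw [← lineInt_sum _ fun j _ => (H.isTame_div _ hx).const_mul _]
    refine lineInt_congr_range fun t => ?_
    rw [eval_finsetSum, Finset.sum_div]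
    exact Finset.sum_congr rfl fun j _ => by rw [eval_mul, eval_C, mul_div_assoc]
  linear_combination h3 - h2 + h1

/-! ### The rank-one matrix `M = Ψ E Ψ⁻¹` -/

/-- The matrix `Ψ E Ψ⁻¹` at level `n + 1`, where `E` projects on the first column: the rank-one
projector built from the column `(P_n, P_{n+1})` and the row `(-Q_{n+1}, Q_n)`, in which the
factors `e ^ (∓ V / 2)` of the wave functions cancel. -/
noncomputable def M (H : IsModel dV γ ω r) (n : ℕ) (x : ℂ) : Matrix (Fin 2) (Fin 2) ℂ :=
  jacobiG r (n + 1) • !![-((H.P n).eval x * H.Q (n + 1) x), (H.P n).eval x * H.Q n x;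
    -((H.P (n + 1)).eval x * H.Q (n + 1) x), (H.P (n + 1)).eval x * H.Q n x]

lemma matD_succ (n : ℕ) (x : ℂ) : matD dV γ ω r (n + 1) x =
    !![val dV x / 2 + wEntry dV γ ω r n (n + 1) x * jacobiG r (n + 1),
        -(wEntry dV γ ω r n n x * jacobiG r (n + 1));
      wEntry dV γ ω r (n + 1) (n + 1) x * jacobiG r (n + 1),
        -(val dV x / 2) - wEntry dV γ ω r (n + 1) n x * jacobiG r (n + 1)] := by
  rw [matD, Nat.add_sub_cancel]
  ext i j
  fin_cases i <;> fin_cases j <;> simp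
  ring

lemma trace_matD (n : ℕ) (x : ℂ) : (matD dV γ ω r (n + 1) x).trace = 0 := by
  rw [matD_succ, Matrix.trace_fin_two_of, wEntry_comm (n + 1) n]
  ring

lemma trace_M (H : IsModel dV γ ω r) {x : ℂ} (hx : x ∉ closure (Set.range γ)) (n : ℕ) :
    (H.M n x).trace = 1 := by
  rw [M, Matrix.trace_smul, Matrix.trace_fin_two_of, smul_eq_mul,
    ← H.jacobiG_mul_sub_eq_one hx n]
  ring

/-- The determinantal formula `W₁ = Tr (Ψ' E Ψ⁻¹) = Tr (𝒟 M)`. -/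
lemma W1_eq_trace (H : IsModel dV γ ω r) {x : ℂ} (hx : x ∉ closure (Set.range γ)) (n : ℕ) :
    W1 dV γ ω (n + 1) x = (matD dV γ ω r (n + 1) x * H.M n x).trace := by
  rw [W1, H.meanResolvent_eq_sum hx, H.sum_P_mul_Q hx,
    H.eval_derivative_P hx (n := n) n.le_succ le_rfl,
    H.eval_derivative_P hx (n := n) le_rfl n.le_succ, if_pos rfl, if_neg n.succ_ne_self,
    matD_succ, M, Matrix.trace_fin_two]
  simp only [Matrix.mul_apply, Fin.sum_univ_two, Matrix.smul_apply, Matrix.of_apply,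
    Matrix.cons_val_zero, Matrix.cons_val_one, smul_eq_mul]
  linear_combination (val dV x / 2) * H.jacobiG_mul_sub_eq_one hx n

/-- The three-term recursion intertwines consecutive projectors. -/
lemma matR_mul_M (H : IsModel dV γ ω r) {x : ℂ} (hx : x ∉ closure (Set.range γ)) (n : ℕ) :
    matR γ ω r (n + 1) x * H.M n x = H.M (n + 1) x * matR γ ω r (n + 1) x := by
  have hG := H.jacobiG_ne_zero (n + 2)
  have hP : (H.P (n + 2)).eval x = -jacobiG r (n + 1) / jacobiG r (n + 2) * (H.P n).eval x +
      (x - jacobiS γ ω (n + 1)) / jacobiG r (n + 2) * (H.P (n + 1)).eval x := by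
    field_simp
    linear_combination -(H.mul_eval_P_succ x n)
  have hQ : H.Q (n + 2) x = -jacobiG r (n + 1) / jacobiG r (n + 2) * H.Q n x +
      (x - jacobiS γ ω (n + 1)) / jacobiG r (n + 2) * H.Q (n + 1) x := by
    field_simp
    linear_combination -(H.mul_Q_succ hx n)
  ext i j
  simp only [M, matR, hP, hQ]
  fin_cases i <;> fin_cases j <;> simp [Matrix.mul_apply, Fin.sum_univ_two] <;> field_simp <;> ring

/-- `M` satisfies the Lax equation `M' = [𝒟, M]`. -/
lemma hasDerivAt_M (H : IsModel dV γ ω r) {x : ℂ} (hx : x ∉ closure (Set.range γ)) (n : ℕ)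
    (i j : Fin 2) : HasDerivAt (fun z => H.M n z i j)
      ((matD dV γ ω r (n + 1) x * H.M n x - H.M n x * matD dV γ ω r (n + 1) x) i j) x := by
  have p0 := (H.P n).hasDerivAt x
  have p1 := (H.P (n + 1)).hasDerivAt x
  rw [H.eval_derivative_P hx (n := n) le_rfl n.le_succ, if_pos rfl] at p0
  rw [H.eval_derivative_P hx (n := n) n.le_succ le_rfl, if_neg n.succ_ne_self] at p1
  have q0 := H.hasDerivAt_Q hx (n := n) le_rfl n.le_succ
  have q1 := H.hasDerivAt_Q hx (n := n) n.le_succ le_rfl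
  rw [if_pos rfl] at q0
  rw [if_neg n.succ_ne_self] at q1
  have hc := wEntry_comm (dV := dV) (γ := γ) (ω := ω) (r := r) (n + 1) n x
  rw [matD_succ]
  fin_cases i <;> fin_cases j
  · refine ((p0.mul q1).neg.const_mul (jacobiG r (n + 1))).congr_deriv ?_
    simp [M, hc]
    ring
  · refine ((p0.mul q0).const_mul (jacobiG r (n + 1))).congr_deriv ?_
    simp [M, hc]
    ring
  · refine ((p1.mul q1).neg.const_mul (jacobiG r (n + 1))).congr_deriv ?_
    simp [M, hc]
    ring
  · refine ((p1.mul q0).const_mul (jacobiG r (n + 1))).congr_deriv ?_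
    simp [M, hc]
    ring

/-- Differentiating `Tr (A M)` amounts to applying the covariant derivative `A' + [A, 𝒟]`. -/
lemma hasDerivAt_trace_mul_M (H : IsModel dV γ ω r) {x : ℂ} (hx : x ∉ closure (Set.range γ))
    (n : ℕ) {A : ℂ → Matrix (Fin 2) (Fin 2) ℂ} {A' : Matrix (Fin 2) (Fin 2) ℂ}
    (hA : ∀ i j, HasDerivAt (fun z => A z i j) (A' i j) x) :
    HasDerivAt (fun z => (A z * H.M n z).trace)
      ((A' + (A x * matD dV γ ω r (n + 1) x - matD dV γ ω r (n + 1) x * A x)) * H.M n x).trace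
      x := by
  have hM := H.hasDerivAt_M hx n
  have h1 : ∀ X Y : Matrix (Fin 2) (Fin 2) ℂ, (X * Y).trace = ∑ i, ∑ j, X i j * Y j i :=
    fun X Y => by simp only [Matrix.trace, Matrix.diag, Matrix.mul_apply]
  simp only [h1 _ (H.M n _)]
  refine (HasDerivAt.fun_sum fun i _ => HasDerivAt.fun_sum fun j _ =>
    (hA i j).mul (hM j i)).congr_deriv ?_
  set D := matD dV γ ω r (n + 1) x
  have h2 : ∑ i, ∑ j, (A' i j * H.M n x j i + A x i j * (D * H.M n x - H.M n x * D) j i) =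
      (A' * H.M n x).trace + (A x * (D * H.M n x - H.M n x * D)).trace := by
    rw [h1, h1]
    simp only [Finset.sum_add_distrib]
  rw [← h1, h2, Matrix.add_mul, Matrix.trace_add, Matrix.mul_sub, Matrix.sub_mul, Matrix.trace_sub,
    Matrix.trace_sub, ← Matrix.mul_assoc, ← Matrix.mul_assoc (A x) (H.M n x) D,
    Matrix.trace_mul_comm (A x * H.M n x) D, Matrix.mul_assoc D]

end IsModel

/-! ### Rational functions without poles outside those of `V'` -/

/-- Off the poles of `V'`, the function `f` is a polynomial divided by a power of the
denominator of `V'`. -/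
def IsRegular (dV : RatFunc ℂ) (f : ℂ → ℂ) : Prop :=
  ∃ (p : ℂ[X]) (k : ℕ), ∀ x, ¬ IsPole dV x → f x = p.eval x / dV.denom.eval x ^ k

/-- All entries of the matrix function `A` are regular off the poles of `V'`. -/
def IsRegularMatrix (dV : RatFunc ℂ) (A : ℂ → Matrix (Fin 2) (Fin 2) ℂ) : Prop :=
  ∀ i j, IsRegular dV (fun x => A x i j)

section Regular

variable {dV : RatFunc ℂ} {f g : ℂ → ℂ}

lemma IsRegular.polynomial (dV : RatFunc ℂ) (p : ℂ[X]) : IsRegular dV (fun x => p.eval x) :=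
  ⟨p, 0, fun x _ => by simp⟩

lemma IsRegular.const (dV : RatFunc ℂ) (c : ℂ) : IsRegular dV (fun _ => c) := by
  simpa using IsRegular.polynomial dV (C c)

lemma IsRegular.mul (hf : IsRegular dV f) (hg : IsRegular dV g) :
    IsRegular dV (fun x => f x * g x) := by
  obtain ⟨p, k, hp⟩ := hf
  obtain ⟨q, l, hq⟩ := hg
  refine ⟨p * q, k + l, fun x hx => ?_⟩
  simp only
  rw [hp x hx, hq x hx, eval_mul, pow_add, div_mul_div_comm]

lemma IsRegular.add (hf : IsRegular dV f) (hg : IsRegular dV g) :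
    IsRegular dV (fun x => f x + g x) := by
  obtain ⟨p, k, hp⟩ := hf
  obtain ⟨q, l, hq⟩ := hg
  refine ⟨p * dV.denom ^ l + q * dV.denom ^ k, k + l, fun x hx => ?_⟩
  have hb : dV.denom.eval x ≠ 0 := hx
  simp only
  rw [hp x hx, hq x hx, eval_add, eval_mul, eval_mul, eval_pow, eval_pow]
  field_simp
  ring

lemma IsRegular.neg (hf : IsRegular dV f) : IsRegular dV (fun x => -f x) := by
  simpa using (IsRegular.const dV (-1)).mul hf

lemma IsRegular.sub (hf : IsRegular dV f) (hg : IsRegular dV g) :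
    IsRegular dV (fun x => f x - g x) := by
  simpa [sub_eq_add_neg] using hf.add hg.neg

lemma IsRegular.congr (hf : IsRegular dV f) (h : ∀ x, ¬ IsPole dV x → g x = f x) :
    IsRegular dV g := by
  obtain ⟨p, k, hp⟩ := hf
  exact ⟨p, k, fun x hx => (h x hx).trans (hp x hx)⟩

lemma val_eq_div (dV : RatFunc ℂ) (x : ℂ) : val dV x = dV.num.eval x / dV.denom.eval x := by
  simp [val, RatFunc.eval, eval₂_eq_eval_map]

lemma IsRegular.val (dV : RatFunc ℂ) : IsRegular dV (fun x => val dV x) :=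
  ⟨dV.num, 1, fun x _ => by simp only [val_eq_div, pow_one]⟩

lemma isOpen_not_isPole (dV : RatFunc ℂ) : IsOpen {x | ¬ IsPole dV x} :=
  isOpen_ne_fun dV.denom.continuous continuous_const

lemma IsRegular.hasDerivAt_and_deriv (hf : IsRegular dV f) :
    (∀ x, ¬ IsPole dV x → HasDerivAt f (deriv f x) x) ∧ IsRegular dV (deriv f) := by
  obtain ⟨p, k, hp⟩ := hf
  have key : ∀ x, ¬ IsPole dV x → HasDerivAt f
      ((p.derivative * dV.denom ^ k - p * (dV.denom ^ k).derivative).eval x /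
        dV.denom.eval x ^ (k * 2)) x := by
    intro x hx
    have hb : dV.denom.eval x ≠ 0 := hx
    have hq : (dV.denom ^ k).eval x ≠ 0 := by
      rw [eval_pow]
      exact pow_ne_zero k hb
    refine (((p.hasDerivAt x).div ((dV.denom ^ k).hasDerivAt x) hq).congr_deriv
      ?_).congr_of_eventuallyEq ?_
    · rw [eval_sub, eval_mul, eval_mul, eval_pow, pow_mul]
    · filter_upwards [(isOpen_not_isPole dV).mem_nhds hx] with z hz
      rw [hp z hz, Pi.div_apply, eval_pow]
  exact ⟨fun x hx => (key x hx).differentiableAt.hasDerivAt,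
    _, _, fun x hx => (key x hx).deriv⟩

lemma IsRegularMatrix.mul {A B : ℂ → Matrix (Fin 2) (Fin 2) ℂ} (hA : IsRegularMatrix dV A)
    (hB : IsRegularMatrix dV B) : IsRegularMatrix dV (fun x => A x * B x) := by
  intro i j
  simp only [Matrix.mul_apply, Fin.sum_univ_two]
  exact ((hA i 0).mul (hB 0 j)).add ((hA i 1).mul (hB 1 j))

/-- More vectors of regular functions than entries satisfy a nontrivial linear relation with
polynomial coefficients. -/
lemma exists_polynomial_relation {ι : Type*} [Fintype ι] {m : ℕ} (hm : Fintype.card ι < m)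
    (f : Fin m → ι → ℂ → ℂ) (hf : ∀ k i, IsRegular dV (f k i)) :
    ∃ C : Fin m → ℂ[X], C ≠ 0 ∧
      ∀ x, ¬ IsPole dV x → ∀ i, ∑ k, (C k).eval x * f k i x = 0 := by
  choose p e hp using hf
  set K := ∑ k, ∑ i, e k i with hK
  have hle : ∀ k i, e k i ≤ K := fun k i =>
    (Finset.single_le_sum (f := fun i => e k i) (fun _ _ => Nat.zero_le _)
      (Finset.mem_univ i)).trans
    (Finset.single_le_sum (f := fun k => ∑ i, e k i) (fun _ _ => Nat.zero_le _)
      (Finset.mem_univ k))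
  let v : Fin m → ι → ℂ[X] := fun k i => p k i * dV.denom ^ (K - e k i)
  have hv : ¬ LinearIndependent ℂ[X] v := by
    intro hli
    have := hli.fintype_card_le_finrank
    rw [Module.finrank_fintype_fun_eq_card, Fintype.card_fin] at this
    omega
  obtain ⟨c, hc, k₀, hk₀⟩ := Fintype.not_linearIndependent_iff.1 hv
  refine ⟨c, fun h => hk₀ (congrFun h k₀), fun x hx i => ?_⟩
  have hb : dV.denom.eval x ≠ 0 := hx
  have h1 := congrArg (eval x) (congrFun hc i)
  simp only [Finset.sum_apply, Pi.smul_apply, smul_eq_mul, eval_finsetSum, eval_mul, v, eval_pow,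
    Pi.zero_apply, eval_zero] at h1
  have h2 : dV.denom.eval x ^ K * ∑ k, (c k).eval x * f k i x = 0 := by
    rw [← h1, Finset.mul_sum]
    refine Finset.sum_congr rfl fun k _ => ?_
    rw [hp k i x hx, ← Nat.sub_add_cancel (hle k i), pow_add, Nat.add_sub_cancel]
    field_simp
  exact (mul_eq_zero.1 h2).resolve_left (pow_ne_zero K hb)

end Regular

/-! ### Differentiating linear relations -/

section Relation

variable {E : Type*} [NormedAddCommGroup E] [NormedSpace ℂ E] {U : Set ℂ} {f : ℕ → ℂ → E}
  {T : ℂ → E →ₗ[ℂ] E}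

/-- A relation between `f 0, …, f m`, where `f (k + 1)` is a covariant derivative of `f k`, may be
differentiated to a relation with the same leading coefficient one order higher. -/
lemma exists_relation_succ (hU : IsOpen U)
    (hf : ∀ k, ∀ x ∈ U, HasDerivAt (f k) (f (k + 1) x - T x (f k x)) x) {m : ℕ} {C : ℕ → ℂ[X]}
    (hC : ∀ x ∈ U, ∑ k ∈ Finset.range (m + 1), (C k).eval x • f k x = 0) :
    ∃ C' : ℕ → ℂ[X], C' (m + 1) = C m ∧
      ∀ x ∈ U, ∑ k ∈ Finset.range (m + 2), (C' k).eval x • f k x = 0 := by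
  refine ⟨fun k => (if k ≤ m then derivative (C k) else 0) + if k = 0 then 0 else C (k - 1),
    by simp, fun x hx => ?_⟩
  have h1 : HasDerivAt (fun z => ∑ k ∈ Finset.range (m + 1), (C k).eval z • f k z)
      (∑ k ∈ Finset.range (m + 1), ((C k).eval x • (f (k + 1) x - T x (f k x)) +
        (C k).derivative.eval x • f k x)) x :=
    HasDerivAt.fun_sum fun k _ => ((C k).hasDerivAt x).smul (hf k x hx)
  have h2 : (fun z => ∑ k ∈ Finset.range (m + 1), (C k).eval z • f k z) =ᶠ[𝓝 x] fun _ => 0 :=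
    eventually_of_mem (hU.mem_nhds hx) hC
  have h3 := h1.unique ((hasDerivAt_const x (0 : E)).congr_of_eventuallyEq h2)
  have h4 : ∑ k ∈ Finset.range (m + 1), (C k).eval x • T x (f k x) = 0 := by
    simp only [← map_smul, ← map_sum, hC x hx, map_zero]
  have h5 : ∑ k ∈ Finset.range (m + 2),
      (if k ≤ m then derivative (C k) else 0 : ℂ[X]).eval x • f k x =
      ∑ k ∈ Finset.range (m + 1), (C k).derivative.eval x • f k x := by
    rw [Finset.sum_range_succ, if_neg (by omega), eval_zero, zero_smul, add_zero]
    refine Finset.sum_congr rfl fun k hk => ?_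
    rw [if_pos (Nat.lt_succ_iff.1 (Finset.mem_range.1 hk))]
  have h6 : ∑ k ∈ Finset.range (m + 2), (if k = 0 then 0 else C (k - 1)).eval x • f k x =
      ∑ k ∈ Finset.range (m + 1), (C k).eval x • f (k + 1) x := by
    rw [Finset.sum_range_succ']
    simp
  simp only [eval_add, add_smul, Finset.sum_add_distrib]
  rw [h5, h6, add_comm, ← h3]
  simp only [smul_sub, Finset.sum_add_distrib, Finset.sum_sub_distrib, h4, sub_zero]

lemma exists_relation_add (hU : IsOpen U)
    (hf : ∀ k, ∀ x ∈ U, HasDerivAt (f k) (f (k + 1) x - T x (f k x)) x) {m : ℕ} {C : ℕ → ℂ[X]}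
    (hC : ∀ x ∈ U, ∑ k ∈ Finset.range (m + 1), (C k).eval x • f k x = 0) (j : ℕ) :
    ∃ C' : ℕ → ℂ[X], C' (m + j) = C m ∧
      ∀ x ∈ U, ∑ k ∈ Finset.range (m + j + 1), (C' k).eval x • f k x = 0 := by
  induction j with
  | zero => exact ⟨C, rfl, hC⟩
  | succ j ih =>
    obtain ⟨C', h1, h2⟩ := ih
    obtain ⟨C'', h3, h4⟩ := exists_relation_succ hU hf h2
    exact ⟨C'', h3.trans h1, h4⟩

/-- A nontrivial relation may be replaced by one whose leading coefficient does not vanish: drop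
the vanishing top coefficients and differentiate. -/
lemma exists_relation_last_ne_zero (hU : IsOpen U)
    (hf : ∀ k, ∀ x ∈ U, HasDerivAt (f k) (f (k + 1) x - T x (f k x)) x) {d : ℕ}
    {C : Fin (d + 1) → ℂ[X]} (hC0 : C ≠ 0)
    (hC : ∀ x ∈ U, ∑ k : Fin (d + 1), (C k).eval x • f k x = 0) :
    ∃ C' : Fin (d + 1) → ℂ[X], C' (Fin.last d) ≠ 0 ∧
      ∀ x ∈ U, ∑ k : Fin (d + 1), (C' k).eval x • f k x = 0 := by
  let c : ℕ → ℂ[X] := fun k => if h : k < d + 1 then C ⟨k, h⟩ else 0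
  have hc : ∀ k : Fin (d + 1), c k = C k := fun k => dif_pos k.2
  have hex : ∃ m, m ≤ d ∧ c m ≠ 0 ∧ ∀ k, m < k → c k = 0 := by
    obtain ⟨k₀, hk₀⟩ : ∃ k, C k ≠ 0 := by
      by_contra hcon
      push Not at hcon
      exact hC0 (funext hcon)
    set s := Finset.univ.filter fun k : Fin (d + 1) => C k ≠ 0 with hs
    have hne : s.Nonempty := ⟨k₀, by simp [hs, hk₀]⟩
    refine ⟨s.max' hne, Nat.lt_succ_iff.1 (s.max' hne).2, ?_, fun k hk => ?_⟩
    · rw [hc]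
      exact (Finset.mem_filter.1 (s.max'_mem hne)).2
    · by_contra hk0
      by_cases hkd : k < d + 1
      · have : (⟨k, hkd⟩ : Fin (d + 1)) ∈ s := by
          simp only [hs, Finset.mem_filter, Finset.mem_univ, true_and]
          rwa [← hc ⟨k, hkd⟩]
        exact absurd (s.le_max' _ this) (not_le.2 hk)
      · exact hk0 (dif_neg hkd)
  obtain ⟨m, hmd, hm, htop⟩ := hex
  have hrel : ∀ x ∈ U, ∑ k ∈ Finset.range (m + 1), (c k).eval x • f k x = 0 := by
    intro x hx
    rw [← hC x hx]
    simp only [← hc]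
    rw [Fin.sum_univ_eq_sum_range (fun k => (c k).eval x • f k x)]
    refine Finset.sum_subset (Finset.range_mono (by omega)) fun k _ hk => ?_
    rw [htop k (by simpa using hk), eval_zero, zero_smul]
  obtain ⟨C', h1, h2⟩ := exists_relation_add hU hf hrel (d - m)
  rw [Nat.add_sub_cancel' hmd] at h1 h2
  refine ⟨fun k => C' k, ?_, fun x hx => ?_⟩
  · simp only [Fin.val_last, h1]
    exact hm
  · rw [Fin.sum_univ_eq_sum_range (fun k => (C' k).eval x • f k x)]
    exact h2 x hx

end Relation

/-! ### Regularity of the matrices of the system -/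

/-- The divided difference of a polynomial is a polynomial in two variables. -/
lemma exists_sub_eq_mul_evalEval (a : ℂ[X]) : ∃ q : ℂ[X][X], ∀ x y,
    a.eval x - a.eval y = (x - y) * q.evalEval x y := by
  obtain ⟨q, hq⟩ := sub_dvd_eval_sub (C X) (X : ℂ[X][X]) (a.map (C.comp C : ℂ →+* ℂ[X][X]))
  refine ⟨q, fun x y => ?_⟩
  have h1 := congrArg (evalEvalRingHom x y) hq
  have h2 : (evalEvalRingHom x y).comp (C.comp C : ℂ →+* ℂ[X][X]) = RingHom.id ℂ := by
    ext z
    simp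
  rw [map_sub, map_mul, map_sub, eval_map, eval_map, hom_eval₂, hom_eval₂, h2] at h1
  simpa [eval₂_eq_eval_map] using h1

section

variable {dV : RatFunc ℂ} {γ ω : ℝ → ℂ} {r : ℕ → ℂ}

lemma IsTame.evalEval_mul {f : ℂ → ℂ} (hf : IsTame γ ω f) (q : ℂ[X][X]) (x : ℂ) :
    IsTame γ ω (fun y => q.evalEval x y * f y) := by
  simpa only [map_evalRingHom_eval] using hf.polynomial_mul (q.map (evalRingHom x))

lemma exists_lineInt_evalEval_eq_eval {f : ℂ → ℂ} (hf : IsTame γ ω f) (q : ℂ[X][X]) :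
    ∃ p : ℂ[X], ∀ x, lineInt γ ω (fun y => q.evalEval x y * f y) = p.eval x := by
  induction q using Polynomial.induction_on' with
  | add q₁ q₂ h₁ h₂ =>
    obtain ⟨p₁, h₁⟩ := h₁
    obtain ⟨p₂, h₂⟩ := h₂
    refine ⟨p₁ + p₂, fun x => ?_⟩
    rw [eval_add, ← h₁, ← h₂, ← lineInt_add (hf.evalEval_mul q₁ x) (hf.evalEval_mul q₂ x)]
    simp only [evalEval_add, add_mul]
  | monomial n a =>
    refine ⟨a * C (lineInt γ ω (fun y => y ^ n * f y)), fun x => ?_⟩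
    rw [eval_mul, eval_C, ← lineInt_const_mul]
    congr 1
    ext y
    simp [evalEval, eval_monomial, mul_assoc]

namespace IsModel

/-- With `V' = a / b`, the function `b(x) (V'(x) - V'(y)) / (x - y)` equals
`(a(x) - a(y)) / (x - y) - V'(y) (b(x) - b(y)) / (x - y)`, a polynomial in `x` with coefficients
integrable in `y`. -/
lemma isRegular_wEntry (H : IsModel dV γ ω r) (n m : ℕ) :
    IsRegular dV (wEntry dV γ ω r n m) := by
  obtain ⟨qa, hqa⟩ := exists_sub_eq_mul_evalEval dV.num
  obtain ⟨qb, hqb⟩ := exists_sub_eq_mul_evalEval dV.denom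
  have ta := H.adm.isTame_polynomial (H.P n * H.P m)
  have tb := H.adm.isTame_val_mul (H.P n * H.P m)
  obtain ⟨pa, hpa⟩ := exists_lineInt_evalEval_eq_eval ta qa
  obtain ⟨pb, hpb⟩ := exists_lineInt_evalEval_eq_eval tb qb
  refine ⟨pa - pb, 1, fun x hx => ?_⟩
  have hb : dV.denom.eval x ≠ 0 := hx
  rw [H.wEntry_eq, pow_one, eval_sub, ← hpa, ← hpb,
    ← lineInt_sub (ta.evalEval_mul qa x) (tb.evalEval_mul qb x), div_eq_inv_mul,
    ← lineInt_const_mul]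
  -- the kernel has a junk value at `y = x` and at the poles of `V'`
  refine lineInt_congr_of_finite H.adm.injective
    ((finite_setOf_isPole dV).union (Set.finite_singleton x)) fun y hy => ?_
  simp only [Set.mem_union, Set.mem_ofPred_eq, Set.mem_singleton_iff, not_or] at hy
  have hby : dV.denom.eval y ≠ 0 := hy.1
  have hxy : x - y ≠ 0 := sub_ne_zero.2 (Ne.symm hy.2)
  rw [eq_comm, inv_mul_eq_iff_eq_mul₀ hb, eval_mul]
  have ha' := hqa x y
  have hb' := hqb x y
  have hvx : val dV x * dV.denom.eval x = dV.num.eval x := by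
    rw [val_eq_div, div_mul_cancel₀ _ hb]
  have hvy : val dV y * dV.denom.eval y = dV.num.eval y := by
    rw [val_eq_div, div_mul_cancel₀ _ hby]
  field_simp
  linear_combination ((H.P n).eval y * (H.P m).eval y) *
    (val dV y * hb' - ha' + hvy - hvx)

lemma isRegularMatrix_matD (H : IsModel dV γ ω r) (n : ℕ) :
    IsRegularMatrix dV (matD dV γ ω r (n + 1)) := by
  have hw := H.isRegular_wEntry
  have hG := IsRegular.const dV (jacobiG r (n + 1))
  have hv : IsRegular dV (fun x => val dV x / 2) := by
    simpa only [div_eq_mul_inv] using (IsRegular.val dV).mul (IsRegular.const dV 2⁻¹)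
  intro i j
  simp only [matD_succ]
  fin_cases i <;> fin_cases j
  · exact hv.add ((hw _ _).mul hG)
  · exact ((hw _ _).mul hG).neg
  · exact (hw _ _).mul hG
  · exact hv.neg.sub ((hw _ _).mul hG)

end IsModel

lemma isRegularMatrix_matR (dV : RatFunc ℂ) (n : ℕ) :
    IsRegularMatrix dV (matR γ ω r n) := by
  intro i j
  fin_cases i <;> fin_cases j
  · exact IsRegular.const dV 0
  · exact IsRegular.const dV 1
  · exact IsRegular.const dV _
  · refine (IsRegular.polynomial dV
      ((X - C (jacobiS γ ω n)) * C (jacobiG r (n + 1))⁻¹)).congr fun x _ => ?_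
    simp [matR, div_eq_mul_inv]

lemma isRegularMatrix_iterR (dV : RatFunc ℂ) (n k : ℕ) :
    IsRegularMatrix dV (iterR γ ω r n k) := by
  induction k with
  | zero => exact fun i j => IsRegular.const dV _
  | succ k ih => exact (isRegularMatrix_matR dV (n + k)).mul ih

namespace IsModel

/-- The determinant does not depend on `x`, so the inverse shift matrices are polynomial in `x`. -/
lemma exists_det_iterR_eq (H : IsModel dV γ ω r) (n k : ℕ) :
    ∃ c ≠ 0, ∀ x, (iterR γ ω r n k x).det = c := by
  induction k with
  | zero => exact ⟨1, one_ne_zero, fun x => Matrix.det_one⟩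
  | succ k ih =>
    obtain ⟨c, hc, h⟩ := ih
    refine ⟨jacobiG r (n + k) / jacobiG r (n + k + 1) * c,
      mul_ne_zero (div_ne_zero (H.jacobiG_ne_zero _) (H.jacobiG_ne_zero _)) hc, fun x => ?_⟩
    rw [iterR, Matrix.det_mul, h, matR, Matrix.det_fin_two_of]
    ring

lemma isUnit_det_iterR (H : IsModel dV γ ω r) (n k : ℕ) (x : ℂ) :
    IsUnit (iterR γ ω r n k x).det := by
  obtain ⟨c, hc, h⟩ := H.exists_det_iterR_eq n k
  rw [h]
  exact hc.isUnit

lemma isRegularMatrix_shiftD (H : IsModel dV γ ω r) (n k : ℕ) :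
    IsRegularMatrix dV (shiftD dV γ ω r (n + 1) k) := by
  have hinv : IsRegularMatrix dV (fun x => (iterR γ ω r (n + 1) k x)⁻¹) := by
    obtain ⟨c, hc, h⟩ := H.exists_det_iterR_eq (n + 1) k
    have hR := isRegularMatrix_iterR (γ := γ) (ω := ω) (r := r) dV (n + 1) k
    intro i j
    simp only [Matrix.inv_def, h, Ring.inverse_eq_inv', Matrix.adjugate_fin_two, Matrix.smul_apply,
      smul_eq_mul]
    refine (IsRegular.const dV _).mul ?_
    fin_cases i <;> fin_cases j
    · exact hR 1 1
    · exact (hR 0 1).neg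
    · exact (hR 1 0).neg
    · exact hR 0 0
  have hD := H.isRegularMatrix_matD (n + k)
  rw [Nat.add_right_comm] at hD
  exact (hinv.mul hD).mul (isRegularMatrix_iterR dV (n + 1) k)

lemma iterR_mul_M (H : IsModel dV γ ω r) {x : ℂ} (hx : x ∉ closure (Set.range γ)) (n k : ℕ) :
    iterR γ ω r (n + 1) k x * H.M n x = H.M (n + k) x * iterR γ ω r (n + 1) k x := by
  induction k with
  | zero => simp [iterR]
  | succ k ih =>
    have h1 := H.matR_mul_M hx (n + k)
    rw [iterR, Matrix.mul_assoc, ih, ← Matrix.mul_assoc, Nat.add_right_comm, h1, Matrix.mul_assoc]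
    rfl

/-- Conjugation by the shift matrices transports `M` from level `n + 1 + k` to level `n + 1`. -/
lemma trace_shiftD_mul_M (H : IsModel dV γ ω r) {x : ℂ} (hx : x ∉ closure (Set.range γ))
    (n k : ℕ) : (shiftD dV γ ω r (n + 1) k x * H.M n x).trace = W1 dV γ ω (n + 1 + k) x := by
  have h1 := H.W1_eq_trace hx (n + k)
  rw [Nat.add_right_comm] at h1
  rw [shiftD, Matrix.mul_assoc, H.iterR_mul_M hx, Matrix.mul_assoc, Matrix.trace_mul_comm,
    Matrix.mul_assoc, Matrix.mul_assoc, Matrix.mul_nonsing_inv _ (H.isUnit_det_iterR _ k x),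
    Matrix.mul_one, h1]

end IsModel

end

/-! ### The covariant derivative and derivatives of the resolvent -/

/-- The covariant derivative `A' + [A, D]`. -/
noncomputable def covDeriv (D A : ℂ → Matrix (Fin 2) (Fin 2) ℂ) (x : ℂ) :
    Matrix (Fin 2) (Fin 2) ℂ :=
  Matrix.of (fun i j => deriv (fun y => A y i j) x) + (A x * D x - D x * A x)

section

variable {dV : RatFunc ℂ} {γ ω : ℝ → ℂ} {r : ℕ → ℂ}

lemma IsRegularMatrix.covDeriv {D A : ℂ → Matrix (Fin 2) (Fin 2) ℂ} (hD : IsRegularMatrix dV D)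
    (hA : IsRegularMatrix dV A) : IsRegularMatrix dV (covDeriv D A) := fun i j =>
  (hA i j).hasDerivAt_and_deriv.2.add (((hA.mul hD) i j).sub ((hD.mul hA) i j))

lemma trace_covDeriv {D A : ℂ → Matrix (Fin 2) (Fin 2) ℂ} (hA : ∀ x, (A x).trace = 0) (x : ℂ) :
    (covDeriv D A x).trace = 0 := by
  have h1 : (fun y => A y 1 1) = fun y => -A y 0 0 := funext fun y => by
    have := hA y
    rw [Matrix.trace_fin_two] at this
    linear_combination this
  rw [covDeriv, Matrix.trace_add, Matrix.trace_sub, Matrix.trace_mul_comm, sub_self, add_zero,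
    Matrix.trace_fin_two, Matrix.of_apply, Matrix.of_apply, h1, deriv.fun_neg, add_neg_cancel]

/-- The points of the plane at which the resolvent is considered. -/
def resolventSet (dV : RatFunc ℂ) (γ : ℝ → ℂ) : Set ℂ :=
  {x | ¬ IsPole dV x} ∩ (closure (Set.range γ))ᶜ

lemma isOpen_resolventSet (dV : RatFunc ℂ) (γ : ℝ → ℂ) : IsOpen (resolventSet dV γ) :=
  (isOpen_not_isPole dV).inter isClosed_closure.isOpen_compl

lemma trace_sum_smul_mul {m : ℕ} (c : Fin m → ℂ) (A : Fin m → Matrix (Fin 2) (Fin 2) ℂ)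
    (B : Matrix (Fin 2) (Fin 2) ℂ) :
    ((∑ k, c k • A k) * B).trace = ∑ k, c k * (A k * B).trace := by
  simp only [Finset.sum_mul, Matrix.trace_sum, Matrix.smul_mul, Matrix.trace_smul, smul_eq_mul]

/-- Traceless `2 × 2` matrices form a space of dimension three, whence four of them are
dependent. -/
lemma exists_relation_of_trace_eq_zero {A : Fin 4 → ℂ → Matrix (Fin 2) (Fin 2) ℂ}
    (hA : ∀ k, IsRegularMatrix dV (A k)) (htr : ∀ k x, (A k x).trace = 0) :
    ∃ C : Fin 4 → ℂ[X], C ≠ 0 ∧ ∀ x, ¬ IsPole dV x → ∑ k, (C k).eval x • A k x = 0 := by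
  let e : Fin 3 → Fin 2 × Fin 2 := ![(0, 0), (0, 1), (1, 0)]
  obtain ⟨C, hC0, hC⟩ := exists_polynomial_relation (dV := dV) (ι := Fin 3) (m := 4) (by simp)
    (fun k i x => A k x (e i).1 (e i).2) fun k i => hA k _ _
  refine ⟨C, hC0, fun x hx => ?_⟩
  have h00 := hC x hx 0
  have h01 := hC x hx 1
  have h10 := hC x hx 2
  have h11 : ∑ k, (C k).eval x * A k x 1 1 = 0 := by
    have : ∀ k, A k x 1 1 = -A k x 0 0 := fun k => by
      have := htr k x
      rw [Matrix.trace_fin_two] at this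
      linear_combination this
    simp only [this, mul_neg, Finset.sum_neg_distrib, neg_eq_zero]
    exact h00
  ext i j
  simp only [Matrix.sum_apply, Matrix.smul_apply, smul_eq_mul, Matrix.zero_apply]
  fin_cases i <;> fin_cases j
  · exact h00
  · exact h01
  · exact h10
  · exact h11

namespace IsModel

lemma iteratedDeriv_eq_trace (H : IsModel dV γ ω r) {n : ℕ}
    {A : ℕ → ℂ → Matrix (Fin 2) (Fin 2) ℂ} (hA0 : IsRegularMatrix dV (A 0))
    (hA : ∀ k, A (k + 1) = covDeriv (matD dV γ ω r (n + 1)) (A k)) {f : ℂ → ℂ}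
    (hf : ∀ x ∈ resolventSet dV γ, f x = (A 0 x * H.M n x).trace) (k : ℕ) :
    IsRegularMatrix dV (A k) ∧ ∀ x ∈ resolventSet dV γ,
      iteratedDeriv k f x = (A k x * H.M n x).trace ∧
      HasDerivAt (iteratedDeriv k f) ((A (k + 1) x * H.M n x).trace) x := by
  have hreg : ∀ k, IsRegularMatrix dV (A k) := fun k => by
    induction k with
    | zero => exact hA0
    | succ k ih =>
      rw [hA]
      exact (H.isRegularMatrix_matD n).covDeriv ih
  refine ⟨hreg k, ?_⟩
  have step : ∀ k, (∀ x ∈ resolventSet dV γ, iteratedDeriv k f x = (A k x * H.M n x).trace) →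
      ∀ x ∈ resolventSet dV γ,
        HasDerivAt (iteratedDeriv k f) ((A (k + 1) x * H.M n x).trace) x := by
    intro k hk x hx
    rw [hA]
    exact (H.hasDerivAt_trace_mul_M hx.2 n fun i j =>
      (hreg k i j).hasDerivAt_and_deriv.1 x hx.1).congr_of_eventuallyEq
        (eventually_of_mem ((isOpen_resolventSet dV γ).mem_nhds hx) hk)
  have heq : ∀ k, ∀ x ∈ resolventSet dV γ, iteratedDeriv k f x = (A k x * H.M n x).trace := by
    intro k
    induction k with
    | zero => simpa using hf
    | succ k ih =>
      intro x hx
      rw [iteratedDeriv_succ]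
      exact (step k ih x hx).deriv
  exact fun x hx => ⟨heq k x hx, step k (heq k) x hx⟩

/-- As `M` is a column of polynomials times the row `(-Q_{n+1}, Q_n)`, `Tr (A M)` lies in
the two-dimensional space spanned by `Q_n` and `Q_{n+1}` over the rational functions. -/
lemma exists_trace_mul_M_eq (H : IsModel dV γ ω r) (n : ℕ) {A : ℂ → Matrix (Fin 2) (Fin 2) ℂ}
    (hA : IsRegularMatrix dV A) : ∃ u : Fin 2 → ℂ → ℂ, (∀ i, IsRegular dV (u i)) ∧
      ∀ x, (A x * H.M n x).trace = u 0 x * H.Q n x + u 1 x * H.Q (n + 1) x := by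
  have hG := IsRegular.const dV (jacobiG r (n + 1))
  have h0 := IsRegular.polynomial dV (H.P n)
  have h1 := IsRegular.polynomial dV (H.P (n + 1))
  refine ⟨![fun x => jacobiG r (n + 1) *
      (A x 1 0 * (H.P n).eval x + A x 1 1 * (H.P (n + 1)).eval x),
    fun x => -(jacobiG r (n + 1) *
      (A x 0 0 * (H.P n).eval x + A x 0 1 * (H.P (n + 1)).eval x))], fun i => ?_, fun x => ?_⟩
  · fin_cases i
    · exact hG.mul (((hA 1 0).mul h0).add ((hA 1 1).mul h1))
    · exact (hG.mul (((hA 0 0).mul h0).add ((hA 0 1).mul h1))).neg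
  · simp [M, Matrix.trace_fin_two, Matrix.mul_apply, Fin.sum_univ_two]
    ring

/-- Four functions of the form `Tr (A M)` satisfy a nontrivial linear relation. -/
lemma exists_relation_trace (H : IsModel dV γ ω r) (n : ℕ)
    {A : Fin 4 → ℂ → Matrix (Fin 2) (Fin 2) ℂ} (hA : ∀ k, IsRegularMatrix dV (A k)) :
    ∃ C : Fin 4 → ℂ[X], C ≠ 0 ∧
      ∀ x, ¬ IsPole dV x → ∑ k, (C k).eval x * (A k x * H.M n x).trace = 0 := by
  choose u hu hAu using fun k => H.exists_trace_mul_M_eq n (hA k)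
  obtain ⟨C, hC0, hC⟩ := exists_polynomial_relation (dV := dV) (ι := Fin 2) (m := 4) (by simp) u hu
  refine ⟨C, hC0, fun x hx => ?_⟩
  simp only [hAu, mul_add, ← mul_assoc, Finset.sum_add_distrib, ← Finset.sum_mul, hC x hx,
    zero_mul, add_zero]

lemma isRegularMatrix_add_val (A : ℂ → Matrix (Fin 2) (Fin 2) ℂ) (hA : IsRegularMatrix dV A) :
    IsRegularMatrix dV (fun x => A x + (val dV x / 2) • (1 : Matrix (Fin 2) (Fin 2) ℂ)) := by
  intro i j
  have hv : IsRegular dV (fun x => val dV x / 2) := by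
    simpa only [div_eq_mul_inv] using (IsRegular.val dV).mul (IsRegular.const dV 2⁻¹)
  exact (hA i j).add (hv.mul (IsRegular.const dV _))

lemma trace_add_val_mul_M (H : IsModel dV γ ω r) {x : ℂ} (hx : x ∉ closure (Set.range γ)) (n : ℕ)
    (A : Matrix (Fin 2) (Fin 2) ℂ) :
    ((A + (val dV x / 2) • (1 : Matrix (Fin 2) (Fin 2) ℂ)) * H.M n x).trace =
      (A * H.M n x).trace + val dV x / 2 := by
  rw [Matrix.add_mul, Matrix.trace_add, Matrix.smul_mul, Matrix.one_mul, Matrix.trace_smul,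
    H.trace_M hx, smul_eq_mul, mul_one]

lemma trace_shiftD (H : IsModel dV γ ω r) (n k : ℕ) (x : ℂ) :
    (shiftD dV γ ω r (n + 1) k x).trace = 0 := by
  rw [shiftD, Matrix.trace_mul_comm, ← Matrix.mul_assoc,
    Matrix.mul_nonsing_inv _ (H.isUnit_det_iterR _ k x),
    Matrix.one_mul, Nat.add_right_comm, trace_matD]

lemma trace_hatD (n k : ℕ) (x : ℂ) : (hatD dV γ ω r (n + 1) k x).trace = 0 := by
  induction k generalizing x with
  | zero => exact trace_matD n x
  | succ k ih => exact trace_covDeriv ih x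

lemma iteratedDeriv_W1_eq (H : IsModel dV γ ω r) (n k : ℕ) :
    IsRegularMatrix dV (hatD dV γ ω r (n + 1) k) ∧ ∀ x ∈ resolventSet dV γ,
      iteratedDeriv k (W1 dV γ ω (n + 1)) x = (hatD dV γ ω r (n + 1) k x * H.M n x).trace :=
  have h := H.iteratedDeriv_eq_trace (n := n) (A := hatD dV γ ω r (n + 1))
    (H.isRegularMatrix_matD n) (fun _ => rfl) (fun _ hx => H.W1_eq_trace hx.2 n) k
  ⟨h.1, fun x hx => (h.2 x hx).1⟩

open scoped Matrix.Norms.Elementwise in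
/-- Any norm on matrices serves to differentiate the relation between the `𝒟̂⁽ⁿ⁺¹'ᵏ⁾`. -/
lemma exists_relation_hatD (H : IsModel dV γ ω r) (n : ℕ) :
    ∃ C : Fin 4 → ℂ[X], C 3 ≠ 0 ∧ ∀ x, ¬ IsPole dV x →
      ∑ k : Fin 4, (C k).eval x • hatD dV γ ω r (n + 1) k x = 0 := by
  obtain ⟨C, hC0, hC⟩ := exists_relation_of_trace_eq_zero (dV := dV)
    (A := fun k : Fin 4 => hatD dV γ ω r (n + 1) k)
    (fun k => (H.iteratedDeriv_W1_eq n k).1) (fun k => trace_hatD n k)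
  refine exists_relation_last_ne_zero (U := {x | ¬ IsPole dV x}) (f := hatD dV γ ω r (n + 1))
    (T := fun x => LinearMap.mulRight ℂ (matD dV γ ω r (n + 1) x) -
      LinearMap.mulLeft ℂ (matD dV γ ω r (n + 1) x)) (isOpen_not_isPole dV)
    (fun k x hx => ?_) hC0 hC
  refine hasDerivAt_pi.2 fun i => hasDerivAt_pi.2 fun j => ?_
  refine ((H.iteratedDeriv_W1_eq n k).1 i j).hasDerivAt_and_deriv.1 x hx |>.congr_deriv ?_
  simp only [hatD, LinearMap.sub_apply, LinearMap.mulRight_apply, LinearMap.mulLeft_apply,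
    add_sub_cancel_right, Matrix.of_apply]

lemma exists_relation_meanResolvent (H : IsModel dV γ ω r) (n : ℕ) :
    ∃ C : Fin 4 → ℂ[X], C ≠ 0 ∧ ∀ x, ¬ IsPole dV x → x ∉ closure (Set.range γ) →
      ∑ k : Fin 4, (C k).eval x * meanResolvent γ ω (n + 1 + k) x = 0 := by
  obtain ⟨C, hC0, hC⟩ := H.exists_relation_trace n
    fun k : Fin 4 => isRegularMatrix_add_val _ (H.isRegularMatrix_shiftD n k)
  refine ⟨C, hC0, fun x hx hx' => ?_⟩
  rw [← hC x hx]
  refine Finset.sum_congr rfl fun k _ => ?_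
  rw [H.trace_add_val_mul_M hx', H.trace_shiftD_mul_M hx', W1, sub_add_cancel]

lemma exists_relation_iteratedDeriv_meanResolvent (H : IsModel dV γ ω r) (n : ℕ) :
    ∃ C : Fin 4 → ℂ[X], C 3 ≠ 0 ∧ ∀ x, ¬ IsPole dV x → x ∉ closure (Set.range γ) →
      ∑ k : Fin 4, (C k).eval x * iteratedDeriv k (meanResolvent γ ω (n + 1)) x = 0 := by
  let A : ℕ → ℂ → Matrix (Fin 2) (Fin 2) ℂ := fun k => (covDeriv (matD dV γ ω r (n + 1)))^[k]
    fun x => matD dV γ ω r (n + 1) x + (val dV x / 2) • (1 : Matrix (Fin 2) (Fin 2) ℂ)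
  have hA := H.iteratedDeriv_eq_trace (n := n) (A := A) (f := meanResolvent γ ω (n + 1))
    (isRegularMatrix_add_val _ (H.isRegularMatrix_matD n))
    (fun k => Function.iterate_succ_apply' _ _ _) (fun x hx => by
      simp only [A, Function.iterate_zero, id]
      rw [H.trace_add_val_mul_M hx.2, ← H.W1_eq_trace hx.2, W1, sub_add_cancel])
  obtain ⟨C, hC0, hC⟩ := H.exists_relation_trace n fun k : Fin 4 => (hA k).1
  have hder : ∀ k, ∀ x ∈ resolventSet dV γ,
      HasDerivAt (iteratedDeriv k (meanResolvent γ ω (n + 1)))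
        (iteratedDeriv (k + 1) (meanResolvent γ ω (n + 1)) x - (0 : ℂ →ₗ[ℂ] ℂ)
          (iteratedDeriv k (meanResolvent γ ω (n + 1)) x)) x := fun k x hx => by
    rw [LinearMap.zero_apply, sub_zero, ((hA (k + 1)).2 x hx).1]
    exact ((hA k).2 x hx).2
  have hrel : ∀ x ∈ resolventSet dV γ, ∑ k : Fin 4,
      (C k).eval x • iteratedDeriv k (meanResolvent γ ω (n + 1)) x = 0 := fun x hx => by
    rw [← hC x hx.1]
    exact Finset.sum_congr rfl fun k _ => by rw [((hA k).2 x hx).1, smul_eq_mul]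
  obtain ⟨C', h1, h2⟩ := exists_relation_last_ne_zero (T := fun _ => 0)
    (isOpen_resolventSet dV γ) hder hC0 hrel
  exact ⟨C', h1, fun x hx hx' => h2 x ⟨hx, hx'⟩⟩

end IsModel

end

end OneMatrixModel

theorem mainTheorem8 (dV : RatFunc ℂ) (γ ω : ℝ → ℂ) (hadm : IsAdmissible dV γ ω)
    (hZ : ∀ n, partitionFn γ ω n ≠ 0)
    (r : ℕ → ℂ) (hr : ∀ n, r n ^ 2 = normSq γ ω n) (N : ℕ) (hN : 1 ≤ N) :
    -- the trace of `𝒟⁽ᴺ⁾` vanishes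
    (∀ x, ¬ IsPole dV x → (matD dV γ ω r N x).trace = 0) ∧
    -- recursion: existence of the coefficients, and what they imply
    (∃ C : Fin 4 → ℂ[X], C ≠ 0 ∧
      ∀ x, ¬ IsPole dV x → ∑ k : Fin 4, (C k).eval x • shiftD dV γ ω r N k x = 0) ∧
    (∀ C : Fin 4 → ℂ[X],
      (∀ x, ¬ IsPole dV x → ∑ k : Fin 4, (C k).eval x • shiftD dV γ ω r N k x = 0) →
      ∀ x, ¬ IsPole dV x → x ∉ closure (Set.range γ) →
        ∑ k : Fin 4, (C k).eval x * W1 dV γ ω (N + k) x = 0) ∧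
    -- differential equation: existence of the coefficients, and what they imply
    (∃ C : Fin 4 → ℂ[X], C 3 ≠ 0 ∧
      ∀ x, ¬ IsPole dV x → ∑ k : Fin 4, (C k).eval x • hatD dV γ ω r N k x = 0) ∧
    (∀ C : Fin 4 → ℂ[X],
      (∀ x, ¬ IsPole dV x → ∑ k : Fin 4, (C k).eval x • hatD dV γ ω r N k x = 0) →
      ∀ x, ¬ IsPole dV x → x ∉ closure (Set.range γ) →
        ∑ k : Fin 4, (C k).eval x * iteratedDeriv k (W1 dV γ ω N) x = 0) ∧
    -- the same orders for the expectation of `Tr (1 / (x - Λ))` itself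
    (∃ C : Fin 4 → ℂ[X], C ≠ 0 ∧
      ∀ x, ¬ IsPole dV x → x ∉ closure (Set.range γ) →
        ∑ k : Fin 4, (C k).eval x * meanResolvent γ ω (N + k) x = 0) ∧
    (∃ C : Fin 4 → ℂ[X], C 3 ≠ 0 ∧
      ∀ x, ¬ IsPole dV x → x ∉ closure (Set.range γ) →
        ∑ k : Fin 4, (C k).eval x * iteratedDeriv k (meanResolvent γ ω N) x = 0) := by
  obtain ⟨n, rfl⟩ : ∃ n, N = n + 1 := ⟨N - 1, by omega⟩
  have H : IsModel dV γ ω r := ⟨hadm, hZ, hr⟩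
  refine ⟨fun x _ => IsModel.trace_matD n x,
    exists_relation_of_trace_eq_zero (fun k => H.isRegularMatrix_shiftD n k)
      (fun k => H.trace_shiftD n k), fun C hC x hx hx' => ?_,
    H.exists_relation_hatD n, fun C hC x hx hx' => ?_,
    H.exists_relation_meanResolvent n, H.exists_relation_iteratedDeriv_meanResolvent n⟩
  · simp only [← H.trace_shiftD_mul_M hx', ← trace_sum_smul_mul, hC x hx, Matrix.zero_mul,
      Matrix.trace_zero]
  · simp only [(H.iteratedDeriv_W1_eq n _).2 x ⟨hx, hx'⟩, ← trace_sum_smul_mul, hC x hx,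
      Matrix.zero_mul, Matrix.trace_zero]
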